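/- Let $(g,\nabla)$ be a smooth special Kähler structure on the punctured unit disc $B_1^*=\{z\in\mathbb C: 0<|z|<1\}$ with its standard complex structure $I$: $g$ is a Kähler metric with Kähler form $\omega=g(I\cdot,\cdot)$, and $\nabla$ is a flat, torsion-free connection on $TB_1^*$ with $\nabla\omega=0$ and $(\nabla_XI)Y=(\nabla_YI)X$. Let $\Xi=\Xi_0\,dz^3=-\omega(\pi^{1,0},\nabla\pi^{1,0})$ be its associated holomorphic cubic form, where $\pi^{1,0}$ is the projection of the complexified tangent bundle to its $(1,0)$-part, and assume that $\Xi_0$ is meromorphic at the origin, of order exactly $n\in\mathbb Z$ there. Let $\tilde g=\tau^*g_{\mathcal H}$ be the associated hyperbolic metric, where $g_{\mathcal H}=(\operatorname{Im}\tau)^{-2}|d\tau|^2$ is the metric of the upper half-plane and $\tau=\partial W/\partial Z$ is the (local) period map, $(Z,W)$ being local holomorphic functions with $\nabla\, d\operatorname{Re}Z=\nabla\, d\operatorname{Re}W=0$ and $\omega=-d\operatorname{Re}Z\wedge d\operatorname{Re}W$; $\tilde g$ does not depend on the choice of $(Z,W)$. Write $r=|z|$; all $o(1)$ are for $z\to0$.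 A metric $f\,|dz|^2$ is called conical of order $\alpha\in\mathbb R$ (at the origin) if $f=r^{2\alpha}(C+o(1))$ for some constant $C>0$; it has a logarithmic singularity of order $k/2$, $k\in\mathbb Z$, if $f=-r^{k}\log r\,(C+o(1))$ for some constant $C>0$; it has a cusp if $f=(C+o(1))/(r\log r)^{2}$ for some constant $C>0$. Then: 1. For every $\beta\in\mathbb R$, $g$ is conical of order $\beta/2$, that is $g=r^{\beta}(C+o(1))|dz|^2$ for some $C>0$, if and only if $\tilde g$ is conical of order $n-\beta$, that is $\tilde g=r^{2(n-\beta)}(C'+o(1))|dz|^2$ for some $C'>0$; and in this case $n-\beta>-1$. 2. $g$ has a logarithmic singularity (of some order $k/2$, $k\in\mathbb Z$) if and only if $\tilde g$ has a cusp; moreover this holds if and only if $g$ has a logarithmic singularity of order $(n+1)/2$, that is, $g=-r^{n+1}\log r\,(C+o(1))|dz|^2$ for some $C>0$ if and only if $\tilde g=\dfrac{C'+o(1)}{(r\log r)^2}|dz|^2$ for some $C'>0$. -/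

import Mathlib

open Filter Topology
open scoped ContDiff

/-- The punctured unit disc `{0 < |z| < 1}`. -/
def puncturedDisc : Set ℂ := {z | 0 < ‖z‖ ∧ ‖z‖ < 1}

/-- The standard Kähler form on `ℂ`, `(X, Y) ↦ ⟨iX, Y⟩`, that is `dx ∧ dy`. -/
noncomputable def stdKahlerForm (X Y : ℂ) : ℝ := inner ℝ (Complex.I * X) Y

/-- A (smooth) special Kähler structure `(g, ∇)` on the punctured unit disc with its standard
complex structure `I` (multiplication by `i`).  All tensors are written in the global coordinate
`z`, and the tangent space at each point is `ℂ`, viewed as a real plane.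
In complex dimension one the Kähler metrics are exactly the metrics `g = dens · |dz|²` with
`dens > 0`; the Kähler form is then `ω(X, Y) = g(I X, Y) = dens · dx ∧ dy` (closed for reasons of
degree). The connection is `∇_X Y = D_X Y + conn(X) Y` with a smooth `conn`, real bilinear in
`(X, Y)`. -/
structure SpecialKahlerStructure where
  /-- the density `e^{-u}` of the metric `g = e^{-u} |dz|²` -/
  dens : ℂ → ℝ
  /-- the connection form of `∇` in the trivialization by the coordinate fields -/
  conn : ℂ → ℂ →ₗ[ℝ] ℂ →ₗ[ℝ] ℂ
  dens_smooth : ContDiffOn ℝ ∞ dens puncturedDisc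
  dens_pos : ∀ z ∈ puncturedDisc, 0 < dens z
  conn_smooth : ∀ X Y : ℂ, ContDiffOn ℝ ∞ (fun z => conn z X Y) puncturedDisc
  /-- `∇` is flat: `R(X, Y) V = ∇_X ∇_Y V - ∇_Y ∇_X V = 0` for constant `X`, `Y`, `V` -/
  flat : ∀ z ∈ puncturedDisc, ∀ X Y V : ℂ,
    fderiv ℝ (fun w => conn w Y V) z X - fderiv ℝ (fun w => conn w X V) z Y
      + conn z X (conn z Y V) - conn z Y (conn z X V) = 0
  /-- `∇` is torsion-free -/
  torsion_free : ∀ z ∈ puncturedDisc, ∀ X Y : ℂ, conn z X Y = conn z Y X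
  /-- `∇` is symplectic: `X (ω(Y, V)) = ω(∇_X Y, V) + ω(Y, ∇_X V)` for constant `Y`, `V` -/
  symplectic : ∀ z ∈ puncturedDisc, ∀ X Y V : ℂ,
    fderiv ℝ (fun w => dens w * stdKahlerForm Y V) z X
      = dens z * stdKahlerForm (conn z X Y) V + dens z * stdKahlerForm Y (conn z X V)
  /-- `(∇_X I) Y = (∇_Y I) X` -/
  special : ∀ z ∈ puncturedDisc, ∀ X Y : ℂ,
    conn z X (Complex.I * Y) - Complex.I * conn z X Y
      = conn z Y (Complex.I * X) - Complex.I * conn z Y X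

namespace SpecialKahlerStructure

variable (S : SpecialKahlerStructure)

/-- The Kähler form `ω` at `z`. -/
noncomputable def kahlerForm (z X Y : ℂ) : ℝ := S.dens z * stdKahlerForm X Y

/-- `(∇_X I) Y = ∇_X (I Y) - I ∇_X Y` at `z`. -/
noncomputable def nablaI (z X Y : ℂ) : ℂ :=
  S.conn z X (Complex.I * Y) - Complex.I * S.conn z X Y

/-- The complex bilinear extension of `ω` to the complexified tangent space, in which a pair
`(a, b)` stands for `a + √-1 b` with real tangent vectors `a`, `b`. -/
noncomputable def kahlerFormC (z : ℂ) (X Y : ℂ × ℂ) : ℂ :=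
  ((S.kahlerForm z X.1 Y.1 - S.kahlerForm z X.2 Y.2 : ℝ) : ℂ)
    + ((S.kahlerForm z X.1 Y.2 + S.kahlerForm z X.2 Y.1 : ℝ) : ℂ) * Complex.I

/-- The projection `π^{1,0} X = (X - √-1 I X) / 2` of a real tangent vector to its `(1,0)`-part,
as an element of the complexified tangent space. -/
noncomputable def proj10 (X : ℂ) : ℂ × ℂ := (X / 2, -(Complex.I * X) / 2)

/-- `(∇_Y π^{1,0}) V = -√-1 (∇_Y I) V / 2`. -/
noncomputable def nablaProj10 (z Y V : ℂ) : ℂ × ℂ := (0, -(S.nablaI z Y V) / 2)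

/-- The associated cubic form `Ξ = -ω(π^{1,0}, ∇π^{1,0})`, as a trilinear form. -/
noncomputable def cubicForm (z X Y V : ℂ) : ℂ :=
  -S.kahlerFormC z (proj10 X) (S.nablaProj10 z Y V)

/-- The coefficient `Ξ₀` in `Ξ = Ξ₀ dz³`, i.e. the value of `Ξ` on `(∂_x, ∂_x, ∂_x)`
(note `dz(∂_x) = 1`). -/
noncomputable def cubicCoeff (z : ℂ) : ℂ := S.cubicForm z 1 1 1

/-- `∇ df = 0` on `U`: `X (df(Y)) = df(∇_X Y)` for constant `X`, `Y`. -/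
def IsFlatFunction (U : Set ℂ) (f : ℂ → ℝ) : Prop :=
  ∀ z ∈ U, ∀ X Y : ℂ,
    fderiv ℝ (fun w => fderiv ℝ f w Y) z X = fderiv ℝ f z (S.conn z X Y)

/-- `(Z, W)` is a pair of conjugate special holomorphic coordinates on `U`: `Z`, `W` are
holomorphic, `Re Z` and `Re W` are flat, and `(Re Z, -Re W)` are Darboux coordinates, i.e.
`ω = -dRe Z ∧ dRe W`. The last condition forces `Z' ≠ 0` and `W' ≠ 0` on `U`. -/
structure IsConjugateSpecialPair (U : Set ℂ) (Z W : ℂ → ℂ) : Prop where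
  isOpen : IsOpen U
  subset : U ⊆ puncturedDisc
  holo_Z : DifferentiableOn ℂ Z U
  holo_W : DifferentiableOn ℂ W U
  flat_Z : S.IsFlatFunction U (fun w => (Z w).re)
  flat_W : S.IsFlatFunction U (fun w => (W w).re)
  darboux : ∀ z ∈ U, ∀ X Y : ℂ,
    S.kahlerForm z X Y =
      -(fderiv ℝ (fun w => (Z w).re) z X * fderiv ℝ (fun w => (W w).re) z Y
        - fderiv ℝ (fun w => (Z w).re) z Y * fderiv ℝ (fun w => (W w).re) z X)

/-- The period map `τ = ∂W/∂Z` of a pair of conjugate special holomorphic coordinates. -/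
noncomputable def periodMap (Z W : ℂ → ℂ) (z : ℂ) : ℂ := deriv W z / deriv Z z

/-- The density at `z` of the pull-back `τ^*((Im τ)⁻² |dτ|²)` of the hyperbolic metric of the
upper half-plane by the holomorphic map `τ`. -/
noncomputable def hyperbolicPullback (τ : ℂ → ℂ) (z : ℂ) : ℝ :=
  ‖deriv τ z‖ ^ 2 / (τ z).im ^ 2

/-- The density of the associated hyperbolic metric `g̃ = τ^* g_H`: its value at `z` is computed
from any period map defined near `z` (the value does not depend on the chosen one). -/
noncomputable def hypDens (z : ℂ) : ℝ :=
  Classical.epsilon fun c : ℝ => ∃ (U : Set ℂ) (Z W : ℂ → ℂ),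
    z ∈ U ∧ S.IsConjugateSpecialPair U Z W ∧ c = hyperbolicPullback (periodMap Z W) z

end SpecialKahlerStructure

/-- The metric `f |dz|²` is conical of order `α` at the origin:
`f = r^{2α} (C + o(1))` as `r = |z| → 0`, for some constant `C > 0`. -/
def IsConicalOfOrder (f : ℂ → ℝ) (α : ℝ) : Prop :=
  ∃ C : ℝ, 0 < C ∧ Tendsto (fun z => f z / ‖z‖ ^ (2 * α)) (𝓝[≠] 0) (𝓝 C)

/-- The metric `f |dz|²` has a logarithmic singularity of order `k/2` at the origin:
`f = -r^k log r (C + o(1))` as `r = |z| → 0`, for some constant `C > 0`. -/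
def HasLogSingularity (f : ℂ → ℝ) (k : ℤ) : Prop :=
  ∃ C : ℝ, 0 < C ∧
    Tendsto (fun z => f z / (-(‖z‖ ^ k * Real.log ‖z‖))) (𝓝[≠] 0) (𝓝 C)

/-- The metric `f |dz|²` has a cusp at the origin:
`f = (C + o(1)) / (r log r)²` as `r = |z| → 0`, for some constant `C > 0`. -/
def HasCusp (f : ℂ → ℝ) : Prop :=
  ∃ C : ℝ, 0 < C ∧ Tendsto (fun z => f z * (‖z‖ * Real.log ‖z‖) ^ 2) (𝓝[≠] 0) (𝓝 C)

/-! Write `∇_X Y = D_X Y + a X Y + d X̄ Ȳ`. The structure equations become `∂ log dens = a`, `∂̄a =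
-|d|²` and `Ξ₀ = -(i/2) dens d̄`. Hence `Δ(-log dens) = 4|d|² = 16 |Ξ₀|² / dens²`, and for any
conjugate pair the same quantity is the density of `τ^* g_H`
(`IsConjugateSpecialPair.hyperbolicPullback_eq`). So `g̃ = 16 |Ξ₀|² / dens² · |dz|²` wherever
special coordinates exist.

Since `|Ξ₀|` is asymptotic to a constant times `r^n`, this identity alone matches order `β/2` with
order `n - β`, and `-r^(n+1) log r` with a cusp (`exists_tendsto_pos_iff`). It needs local special
coordinates: eliminating `p̄` from the flatness equation `p' = a p + d̄ p̄` of `p = Z'` leaves a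
holomorphic linear equation of second order, which is solved by Picard iteration
(`exists_isConjugateSpecialPair`).

The bound `n - β > -1` and the fact that a logarithmic singularity has `k = n + 1` are analytic.
They follow from the equation for `Δ(-log dens)` and two consequences of the maximum principle: a
function bounded above and at least `log r - B` cannot have Laplacian `≥ c / r²`
(`false_of_ge_div_norm_sq`), and a function tending to `-∞` more slowly than `log r` cannot have
Laplacian bounded above (`false_of_le`). -/

open ComplexConjugate

/-! ### Wirtinger calculus -/

/-- The real-linear map `X ↦ α X + β X̄`. -/
noncomputable def wirtinger (α β : ℂ) : ℂ →L[ℝ] ℂ :=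
  α • ContinuousLinearMap.id ℝ ℂ + β • (Complex.conjCLE : ℂ →L[ℝ] ℂ)

@[simp]
theorem wirtinger_apply (α β X : ℂ) : wirtinger α β X = α * X + β * conj X := by
  simp [wirtinger]

/-- `f` is real differentiable at `z`, with `∂f/∂z = α` and `∂f/∂z̄ = β`. -/
def HasWirtingerAt (f : ℂ → ℂ) (α β z : ℂ) : Prop := HasFDerivAt f (wirtinger α β) z

namespace HasWirtingerAt

variable {f g : ℂ → ℂ} {α β α' β' z : ℂ}

theorem of_hasFDerivAt {L : ℂ →L[ℝ] ℂ} (h : HasFDerivAt f L z)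
    (hL : ∀ X, L X = α * X + β * conj X) : HasWirtingerAt f α β z := by
  have : L = wirtinger α β := by ext1 X; simp [hL]
  rwa [HasWirtingerAt, ← this]

theorem of_differentiableAt (h : DifferentiableAt ℝ f z) :
    HasWirtingerAt f ((fderiv ℝ f z 1 - Complex.I * fderiv ℝ f z Complex.I) / 2)
      ((fderiv ℝ f z 1 + Complex.I * fderiv ℝ f z Complex.I) / 2) z := by
  refine of_hasFDerivAt h.hasFDerivAt fun X => ?_
  have hX : X = X.re • (1 : ℂ) + X.im • Complex.I := by simp [Complex.re_add_im]
  have : fderiv ℝ f z X = X.re * fderiv ℝ f z 1 + X.im * fderiv ℝ f z Complex.I := by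
    conv_lhs => rw [hX]
    rw [map_add, map_smul, map_smul]; simp
  rw [this]
  have h1 : (X.re : ℂ) = (X + conj X) / 2 := by rw [Complex.add_conj]; push_cast; ring
  have h2 : (X.im : ℂ) = -Complex.I * (X - conj X) / 2 := by
    rw [Complex.sub_conj]; push_cast; linear_combination (X.im : ℂ) * Complex.I_sq
  rw [h1, h2]; ring

theorem of_hasDerivAt (h : HasDerivAt f α z) : HasWirtingerAt f α 0 z :=
  of_hasFDerivAt (h.hasFDerivAt.restrictScalars ℝ) fun X => by simp [mul_comm]

theorem hasDerivAt (h : HasWirtingerAt f α 0 z) : HasDerivAt f α z := by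
  rw [hasDerivAt_iff_hasFDerivAt]
  exact hasFDerivAt_of_restrictScalars ℝ h (by ext X; simp [mul_comm])

theorem add (hf : HasWirtingerAt f α β z) (hg : HasWirtingerAt g α' β' z) :
    HasWirtingerAt (fun w => f w + g w) (α + α') (β + β') z :=
  of_hasFDerivAt (HasFDerivAt.add hf hg) fun X => by simp; ring

theorem sub (hf : HasWirtingerAt f α β z) (hg : HasWirtingerAt g α' β' z) :
    HasWirtingerAt (fun w => f w - g w) (α - α') (β - β') z :=
  of_hasFDerivAt (HasFDerivAt.sub hf hg) fun X => by simp; ring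

theorem mul (hf : HasWirtingerAt f α β z) (hg : HasWirtingerAt g α' β' z) :
    HasWirtingerAt (fun w => f w * g w) (α * g z + f z * α') (β * g z + f z * β') z :=
  of_hasFDerivAt (HasFDerivAt.mul hf hg) fun X => by simp; ring

theorem neg (hf : HasWirtingerAt f α β z) : HasWirtingerAt (fun w => -f w) (-α) (-β) z :=
  of_hasFDerivAt (HasFDerivAt.neg hf) fun X => by simp; ring

theorem conj_comp (hf : HasWirtingerAt f α β z) :
    HasWirtingerAt (fun w => conj (f w)) (starRingEnd ℂ β) (starRingEnd ℂ α) z :=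
  of_hasFDerivAt ((Complex.conjCLE : ℂ →L[ℝ] ℂ).hasFDerivAt.comp z hf) fun X => by
    simp; ring

theorem inv (hf : HasWirtingerAt f α β z) (h0 : f z ≠ 0) :
    HasWirtingerAt (fun w => (f w)⁻¹) (-α / f z ^ 2) (-β / f z ^ 2) z :=
  of_hasFDerivAt (((hasDerivAt_inv h0).hasFDerivAt.restrictScalars ℝ).comp z hf) fun X => by
    simp; ring

theorem div (hf : HasWirtingerAt f α β z) (hg : HasWirtingerAt g α' β' z) (h0 : g z ≠ 0) :
    HasWirtingerAt (fun w => f w / g w) (α / g z - f z * α' / g z ^ 2)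
      (β / g z - f z * β' / g z ^ 2) z :=
  by
  have h := hf.mul (hg.inv h0)
  simp only [← div_eq_mul_inv] at h
  exact of_hasFDerivAt h fun X => by simp; field_simp; ring

theorem congr (hf : HasWirtingerAt f α β z) (h1 : α = α') (h2 : β = β') :
    HasWirtingerAt f α' β' z := h1 ▸ h2 ▸ hf

/-- The mixed Wirtinger derivatives commute. -/
theorem mixed {A B : ℂ → ℂ} (hf : ∀ᶠ w in 𝓝 z, HasWirtingerAt f (A w) (B w) w)
    (hA : HasWirtingerAt A α β z) (hB : HasWirtingerAt B α' β' z) : β = α' := by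
  have hx : HasFDerivAt (fun w => wirtinger (A w) (B w))
      ((wirtinger α β).smulRight (ContinuousLinearMap.id ℝ ℂ)
        + (wirtinger α' β').smulRight (Complex.conjCLE : ℂ →L[ℝ] ℂ)) z := by
    have h1 := HasFDerivAt.smul_const hA (ContinuousLinearMap.id ℝ ℂ)
    have h2 := HasFDerivAt.smul_const hB (Complex.conjCLE : ℂ →L[ℝ] ℂ)
    exact h1.add h2
  have := second_derivative_symmetric_of_eventually hf hx 1 Complex.I
  simp at this
  linear_combination -Complex.I * this / 2 + (β - α') * Complex.I_sq

/-- The derivative along an affine line. -/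
theorem hasDerivAt_line {z₀ ζ : ℂ} {t : ℝ} (hf : HasWirtingerAt f α β (z₀ + t * ζ)) :
    HasDerivAt (fun s : ℝ => f (z₀ + s * ζ)) (α * ζ + β * starRingEnd ℂ ζ) t := by
  have hl : HasDerivAt (fun s : ℝ => z₀ + (s : ℂ) * ζ) ζ t := by
    simpa using (((Complex.ofRealCLM.hasDerivAt (x := t)).mul_const ζ).const_add z₀)
  have hf' : HasFDerivAt f (wirtinger α β) ((fun s : ℝ => z₀ + (s : ℂ) * ζ) t) := hf
  have h := HasFDerivAt.comp_hasDerivAt t hf' hl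
  rwa [wirtinger_apply] at h

end HasWirtingerAt

/-! ### Structure equations of the connection in complex notation -/

theorem isOpen_puncturedDisc : IsOpen puncturedDisc :=
  (isOpen_lt continuous_const continuous_norm).inter (isOpen_lt continuous_norm continuous_const)

theorem stdKahlerForm_eq (X Y : ℂ) : stdKahlerForm X Y = (conj X * Y).im := by
  simp [stdKahlerForm, Complex.inner]; ring

namespace SpecialKahlerStructure

variable (S : SpecialKahlerStructure)

/-- The coefficient `a` in `∇_X Y = D_X Y + a X Y + d X̄ Ȳ`. -/
noncomputable def connHol (z : ℂ) : ℂ := (S.conn z 1 1 - Complex.I * S.conn z 1 Complex.I) / 2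

/-- The coefficient `d` in `∇_X Y = D_X Y + a X Y + d X̄ Ȳ`. -/
noncomputable def connAnti (z : ℂ) : ℂ := (S.conn z 1 1 + Complex.I * S.conn z 1 Complex.I) / 2

variable {S} {z : ℂ}

/-- A symmetric real bilinear map is a combination of `XY`, `X̄Ȳ` and `XȲ + X̄Y`. The condition on
`∇I` at `(1, i)` gives `∇_i i = -∇_1 1`, which kills the mixed term. -/
theorem conn_eq (hz : z ∈ puncturedDisc) (X Y : ℂ) :
    S.conn z X Y = S.connHol z * X * Y + S.connAnti z * conj X * conj Y := by
  have hII : S.conn z Complex.I Complex.I = -S.conn z 1 1 := by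
    have h := S.special z hz 1 Complex.I
    rw [S.torsion_free z hz Complex.I 1, S.torsion_free z hz Complex.I (Complex.I * 1)] at h
    simp at h
    exact h.symm
  have hX : X = X.re • (1 : ℂ) + X.im • Complex.I := by simp [Complex.re_add_im]
  have hY : Y = Y.re • (1 : ℂ) + Y.im • Complex.I := by simp [Complex.re_add_im]
  have : S.conn z X Y = X.re * Y.re * S.conn z 1 1
      + (X.re * Y.im + X.im * Y.re) * S.conn z 1 Complex.I - X.im * Y.im * S.conn z 1 1 := by
    conv_lhs => rw [hX, hY]
    simp only [map_add, map_smul, LinearMap.add_apply, LinearMap.smul_apply]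
    rw [hII, S.torsion_free z hz Complex.I 1]
    simp; ring
  rw [this, connHol, connAnti]
  have h1 (X : ℂ) : (X.re : ℂ) = (X + conj X) / 2 := by rw [Complex.add_conj]; push_cast; ring
  have h2 (X : ℂ) : (X.im : ℂ) = -Complex.I * (X - conj X) / 2 := by
    rw [Complex.sub_conj]; push_cast; linear_combination (X.im : ℂ) * Complex.I_sq
  rw [h1, h1, h2, h2]
  ring_nf; rw [Complex.I_sq]; ring

theorem contDiffOn_connHol : ContDiffOn ℝ ∞ S.connHol puncturedDisc :=
  ((S.conn_smooth 1 1).sub (contDiffOn_const.mul (S.conn_smooth 1 Complex.I))).div_const 2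

theorem contDiffOn_connAnti : ContDiffOn ℝ ∞ S.connAnti puncturedDisc :=
  ((S.conn_smooth 1 1).add (contDiffOn_const.mul (S.conn_smooth 1 Complex.I))).div_const 2

/-- Parallelism of `ω` makes `d log dens` the real trace of the connection form. The part antilinear
in `Y` is trace-free, so the trace is `2 Re (a X)`. -/
theorem hasWirtingerAt_dens (hz : z ∈ puncturedDisc) :
    HasWirtingerAt (fun w => (S.dens w : ℂ)) (S.dens z * S.connHol z)
      (S.dens z * conj (S.connHol z)) z := by
  have hd : DifferentiableAt ℝ S.dens z :=
    (S.dens_smooth.contDiffAt (isOpen_puncturedDisc.mem_nhds hz)).differentiableAt (by simp)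
  refine .of_hasFDerivAt (Complex.ofRealCLM.hasFDerivAt.comp z hd.hasFDerivAt) fun X => ?_
  have h := S.symplectic z hz X 1 Complex.I
  simp only [stdKahlerForm_eq, conn_eq hz] at h
  have e : (fun w => S.dens w * (conj (1 : ℂ) * Complex.I).im) = S.dens := by ext; simp
  rw [e] at h
  simp only [ContinuousLinearMap.comp_apply, h, Complex.ofRealCLM_apply]
  apply Complex.ext <;> simp <;> ring

variable (S) in
/-- The derivative `∂a/∂z` of the coefficient `a` of the connection. -/
noncomputable def connHolDeriv (z : ℂ) : ℂ :=
  (fderiv ℝ S.connHol z 1 - Complex.I * fderiv ℝ S.connHol z Complex.I) / 2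

theorem contDiffOn_connHolDeriv : ContDiffOn ℝ ∞ S.connHolDeriv puncturedDisc := by
  have h : ContDiffOn ℝ ∞ (fderiv ℝ S.connHol) puncturedDisc :=
    contDiffOn_connHol.fderiv_of_isOpen isOpen_puncturedDisc (by simp)
  exact ((h.clm_apply contDiffOn_const).sub
    (contDiffOn_const.mul (h.clm_apply contDiffOn_const))).div_const 2

/-- The `∂/∂z̄`-part of the flatness of `∇`. -/
theorem hasWirtingerAt_connHol (hz : z ∈ puncturedDisc) :
    HasWirtingerAt S.connHol (S.connHolDeriv z) (-(S.connAnti z * conj (S.connAnti z))) z := by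
  have ha := (contDiffOn_connHol (S := S)).contDiffAt (isOpen_puncturedDisc.mem_nhds hz)
    |>.differentiableAt (by simp)
  have hd := (contDiffOn_connAnti (S := S)).contDiffAt (isOpen_puncturedDisc.mem_nhds hz)
    |>.differentiableAt (by simp)
  have ha' := HasWirtingerAt.of_differentiableAt ha
  have hd' := HasWirtingerAt.of_differentiableAt hd
  rw [connHolDeriv]
  set α := (fderiv ℝ S.connHol z 1 - Complex.I * fderiv ℝ S.connHol z Complex.I) / 2
  set β := (fderiv ℝ S.connHol z 1 + Complex.I * fderiv ℝ S.connHol z Complex.I) / 2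
  set γ := (fderiv ℝ S.connAnti z 1 - Complex.I * fderiv ℝ S.connAnti z Complex.I) / 2
  set δ := (fderiv ℝ S.connAnti z 1 + Complex.I * fderiv ℝ S.connAnti z Complex.I) / 2
  have hfd (Y V X : ℂ) : fderiv ℝ (fun w => S.conn w Y V) z X
      = (α * X + β * conj X) * Y * V + (γ * X + δ * conj X) * conj Y * conj V := by
    have e : (fun w => S.conn w Y V) =ᶠ[𝓝 z] fun w =>
        S.connHol w * (Y * V) + S.connAnti w * (conj Y * conj V) := by
      filter_upwards [isOpen_puncturedDisc.mem_nhds hz] with w hw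
      rw [conn_eq hw]; ring
    have h := (HasFDerivAt.mul_const' ha' (Y * V)).fun_add
      (HasFDerivAt.mul_const' hd' (conj Y * conj V))
    rw [e.fderiv_eq, h.fderiv]
    simp; ring
  have key (V : ℂ) := S.flat z hz 1 Complex.I V
  simp only [hfd, conn_eq hz, map_add, map_mul, map_one, Complex.conj_I, Complex.conj_conj] at key
  have k1 := key 1
  have k2 := key Complex.I
  simp only [map_neg, map_one, Complex.conj_I, neg_neg] at k1 k2
  set a := S.connHol z
  set d := S.connAnti z
  -- This combination isolates the complex linear part of the curvature. The antilinear part, which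
  -- amounts to holomorphy of `Ξ₀`, is not needed because `Ξ₀` is assumed meromorphic.
  have h1 : β = -(d * conj d) := by
    linear_combination (-Complex.I * k1 - k2) / 4 + (β + d * conj d) * Complex.I_sq
  exact ha'.congr rfl h1

theorem cubicCoeff_eq (hz : z ∈ puncturedDisc) :
    S.cubicCoeff z = -(Complex.I / 2) * S.dens z * conj (S.connAnti z) := by
  simp only [cubicCoeff, cubicForm, kahlerFormC, proj10, nablaProj10, nablaI, kahlerForm,
    stdKahlerForm_eq, conn_eq hz]
  have h2 : conj (2 : ℂ) = 2 := Complex.conj_ofNat 2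
  apply Complex.ext <;> simp [h2, Complex.normSq] <;> ring

end SpecialKahlerStructure

/-! ### Flat holomorphic differentials and the pulled back hyperbolic metric -/

namespace SpecialKahlerStructure

variable {S : SpecialKahlerStructure} {U : Set ℂ} {Z W p q p' : ℂ → ℂ} {z : ℂ}

theorem fderiv_re_of_hasDerivAt {c : ℂ} (h : HasDerivAt Z c z) (Y : ℂ) :
    fderiv ℝ (fun w => (Z w).re) z Y = (c * Y).re := by
  have := Complex.reCLM.hasFDerivAt.comp z (h.hasFDerivAt.restrictScalars ℝ)
  have h2 : fderiv ℝ (fun w => (Z w).re) z = _ := this.fderiv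
  rw [h2]; simp [mul_comm]

/-- `Re Z` is flat if and only if `Z'` solves the flatness equation. -/
theorem isFlatFunction_re_iff (hU : IsOpen U) (hsub : U ⊆ puncturedDisc)
    (hZ : ∀ w ∈ U, HasDerivAt Z (p w) w) (hp : ∀ w ∈ U, HasDerivAt p (p' w) w) :
    S.IsFlatFunction U (fun w => (Z w).re) ↔
      ∀ w ∈ U, p' w = S.connHol w * p w + conj (S.connAnti w) * conj (p w) := by
  have key : ∀ w ∈ U, ∀ X Y : ℂ,
      fderiv ℝ (fun v => fderiv ℝ (fun u => (Z u).re) v Y) w X = (p' w * X * Y).re := by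
    intro w hw X Y
    have e : (fun v => fderiv ℝ (fun u => (Z u).re) v Y) =ᶠ[𝓝 w] fun v => (p v * Y).re := by
      filter_upwards [hU.mem_nhds hw] with v hv using fderiv_re_of_hasDerivAt (hZ v hv) Y
    rw [e.fderiv_eq, fderiv_re_of_hasDerivAt ((hp w hw).mul_const Y)]
    congr 1; ring
  refine forall₂_congr fun w hw => ?_
  simp only [key w hw, fderiv_re_of_hasDerivAt (hZ w hw), conn_eq (hsub hw)]
  constructor
  · intro h
    have h1 := h 1 1
    have h2 := h 1 Complex.I
    apply Complex.ext
    · simp at h1 ⊢; linarith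
    · simp at h2 ⊢; linarith
  · intro h X Y
    rw [h]; simp; ring

/-- Both sides are alternating forms on a real plane, so the pair `(1, i)` decides. -/
theorem darboux_iff (hZ : HasDerivAt Z (p z) z) (hW : HasDerivAt W (q z) z) :
    (∀ X Y : ℂ, S.kahlerForm z X Y =
      -(fderiv ℝ (fun w => (Z w).re) z X * fderiv ℝ (fun w => (W w).re) z Y
        - fderiv ℝ (fun w => (Z w).re) z Y * fderiv ℝ (fun w => (W w).re) z X)) ↔
      S.dens z = (conj (p z) * q z).im := by
  simp only [fderiv_re_of_hasDerivAt hZ, fderiv_re_of_hasDerivAt hW, kahlerForm, stdKahlerForm_eq]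
  constructor
  · intro h
    have := h 1 Complex.I
    simp at this ⊢; linarith
  · intro h X Y
    rw [h]; simp; ring

theorem norm_sq_cubicCoeff (hz : z ∈ puncturedDisc) :
    ‖S.cubicCoeff z‖ ^ 2 = S.dens z ^ 2 * ‖S.connAnti z‖ ^ 2 / 4 := by
  rw [cubicCoeff_eq hz]
  simp only [norm_mul, norm_neg, norm_div, Complex.norm_I, Complex.norm_real, mul_pow,
    RCLike.norm_conj, Real.norm_eq_abs, sq_abs]
  norm_num
  ring

/-- The pulled back hyperbolic metric does not depend on the conjugate pair. -/
theorem IsConjugateSpecialPair.hyperbolicPullback_eq (h : S.IsConjugateSpecialPair U Z W)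
    (hz : z ∈ U) :
    hyperbolicPullback (periodMap Z W) z = 16 * ‖S.cubicCoeff z‖ ^ 2 / S.dens z ^ 2 := by
  have hd : ∀ {F : ℂ → ℂ}, DifferentiableOn ℂ F U → ∀ w ∈ U, HasDerivAt F (deriv F w) w :=
    fun hF w hw => ((hF w hw).differentiableAt (h.isOpen.mem_nhds hw)).hasDerivAt
  have hZ := hd h.holo_Z
  have hW := hd h.holo_W
  have hZ' := hd (h.holo_Z.deriv h.isOpen)
  have hW' := hd (h.holo_W.deriv h.isOpen)
  have fZ := (isFlatFunction_re_iff h.isOpen h.subset hZ hZ').1 h.flat_Z z hz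
  have fW := (isFlatFunction_re_iff h.isOpen h.subset hW hW').1 h.flat_W z hz
  have hdar := (darboux_iff (hZ z hz) (hW z hz)).1 (h.darboux z hz)
  have hpos := S.dens_pos z (h.subset hz)
  set p := deriv Z z with hp_def
  set q := deriv W z with hq_def
  have hp : p ≠ 0 := by rintro hp; rw [hp] at hdar; simp at hdar; linarith
  -- In `q' p - q p'` the terms in `a` cancel, and the rest is `d̄ (q̄ p - p̄ q)`, which is `-2i d̄
  -- dens` by the Darboux condition. As `Im τ = dens / |p|²`, the factor `p` then drops out of the
  -- pulled back density.
  have hτ : deriv (periodMap Z W) z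
      = -(2 * Complex.I * conj (S.connAnti z) * S.dens z) / p ^ 2 := by
    have e : deriv (periodMap Z W) z = _ := ((hW' z hz).div (hZ' z hz) hp).deriv
    rw [e, fZ, fW]
    congr 1
    have : (S.dens z : ℂ) * (2 * Complex.I) = conj p * q - p * conj q := by
      have := Complex.sub_conj (conj p * q)
      rw [map_mul, Complex.conj_conj] at this
      rw [this, hdar]; push_cast; ring
    rw [← hp_def, ← hq_def]
    linear_combination conj (S.connAnti z) * this
  have him : (periodMap Z W z).im = S.dens z / ‖p‖ ^ 2 := by
    rw [periodMap, hdar, ← hp_def, ← hq_def, ← Complex.normSq_eq_norm_sq, Complex.div_im]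
    simp; ring
  rw [hyperbolicPullback, hτ, him, norm_sq_cubicCoeff (h.subset hz)]
  have : ‖p‖ ≠ 0 := by simpa
  simp only [norm_mul, norm_neg, norm_div, Complex.norm_I, Complex.norm_real, norm_pow,
    RCLike.norm_conj, Real.norm_eq_abs, abs_of_pos hpos]
  norm_num
  field_simp
  ring

/-- As `hypDens` is an `epsilon` term, it carries information only once some pair exists near `z`;
all pairs then give the same value. -/
theorem hypDens_eq (h : ∃ (U : Set ℂ) (Z W : ℂ → ℂ), z ∈ U ∧ S.IsConjugateSpecialPair U Z W) :
    S.hypDens z = 16 * ‖S.cubicCoeff z‖ ^ 2 / S.dens z ^ 2 := by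
  obtain ⟨U, Z, W, hz, hp⟩ := h
  obtain ⟨U', Z', W', hz', hp', he⟩ := Classical.epsilon_spec (p := fun c : ℝ =>
    ∃ (U : Set ℂ) (Z W : ℂ → ℂ),
    z ∈ U ∧ S.IsConjugateSpecialPair U Z W ∧ c = hyperbolicPullback (periodMap Z W) z)
    ⟨_, U, Z, W, hz, hp, rfl⟩
  rw [hypDens, he, hp'.hyperbolicPullback_eq hz']

end SpecialKahlerStructure

/-! ### Local existence of special holomorphic coordinates -/

/-- Linear holomorphic differential equations have local solutions. -/
theorem exists_hasDerivAt_linear {E : Type*} [NormedAddCommGroup E] [NormedSpace ℂ E]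
    [CompleteSpace E] {M : ℂ → E →L[ℂ] E} {z₀ : ℂ} {r K : ℝ} (hr : 0 < r)
    (hM : DifferentiableOn ℂ M (Metric.ball z₀ r)) (hK : ∀ z ∈ Metric.ball z₀ r, ‖M z‖ ≤ K)
    (hKr : K * r < 1) (v : E) :
    ∃ Y : ℂ → E, Y z₀ = v ∧ ∀ z ∈ Metric.ball z₀ r, HasDerivAt Y (M z (Y z)) z := by
  set B := Metric.ball z₀ r with hB
  have hz₀ : z₀ ∈ B := Metric.mem_ball_self hr
  have hK0 : 0 ≤ K := (norm_nonneg _).trans (hK z₀ hz₀)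
  -- One Picard step: the primitive of `M Y` vanishing at `z₀`.
  have step : ∀ Y : {Y : ℂ → E // DifferentiableOn ℂ Y B}, ∃ G : {Y : ℂ → E //
      DifferentiableOn ℂ Y B}, G.1 z₀ = 0 ∧ ∀ z ∈ B, HasDerivAt G.1 (M z (Y.1 z)) z := by
    rintro ⟨Y, hY⟩
    obtain ⟨G, hG0, hG⟩ := (DifferentiableOn.isExactOn_ball (hM.clm_apply hY)).with_val_at z₀ 0
    exact ⟨⟨G, fun z hz => (hG z hz).differentiableAt.differentiableWithinAt⟩, hG0, hG⟩
  choose F hF0 hF using step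
  -- These are the increments of the Picard iteration. They are bounded by `(K r)^n ‖v‖`, so their
  -- sum converges, and differentiating it termwise gives the equation.
  let Y : ℕ → {Y : ℂ → E // DifferentiableOn ℂ Y B} := fun n =>
    Nat.rec ⟨fun _ => v, differentiableOn_const v⟩ (fun _ G => F G) n
  have hY0 : ∀ n, (Y (n + 1)).1 z₀ = 0 := fun n => hF0 (Y n)
  have hYd : ∀ n, ∀ z ∈ B, HasDerivAt (Y (n + 1)).1 (M z ((Y n).1 z)) z := fun n => hF (Y n)
  have hbound : ∀ n, ∀ z ∈ B, ‖(Y n).1 z‖ ≤ (K * r) ^ n * ‖v‖ := by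
    intro n
    induction n with
    | zero => intro z _; simp [Y]
    | succ n ih =>
      intro z hz
      have h := (convex_ball z₀ r).norm_image_sub_le_of_norm_hasDerivWithin_le
        (C := K * ((K * r) ^ n * ‖v‖)) (fun x hx => (hYd n x hx).hasDerivWithinAt)
        (fun x hx => (M x).le_of_opNorm_le_of_le (hK x hx) (ih x hx)) hz₀ hz
      rw [hY0, sub_zero] at h
      refine h.trans ?_
      have hzr : ‖z - z₀‖ ≤ r := by rw [← dist_eq_norm]; exact (Metric.mem_ball.1 hz).le
      calc K * ((K * r) ^ n * ‖v‖) * ‖z - z₀‖ ≤ K * ((K * r) ^ n * ‖v‖) * r := by gcongr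
        _ = (K * r) ^ (n + 1) * ‖v‖ := by ring
  have hs : Summable fun n : ℕ => (K * r) ^ n * ‖v‖ :=
    (summable_geometric_of_lt_one (by positivity) hKr).mul_right _
  have hsY : ∀ z ∈ B, Summable fun n => (Y n).1 z := fun z hz =>
    Summable.of_norm_bounded hs fun n => hbound n z hz
  refine ⟨fun z => v + ∑' n, (Y (n + 1)).1 z, by simp [hY0], fun z hz => ?_⟩
  have h := (hasDerivAt_tsum_of_isPreconnected (hs.mul_left K) Metric.isOpen_ball
    (convex_ball z₀ r).isPreconnected hYd
    (fun n x hx => (M x).le_of_opNorm_le_of_le (hK x hx) (hbound n x hx)) hz₀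
    (by simp [hY0]) hz).const_add v
  have e : v + ∑' n, (Y (n + 1)).1 z = ∑' n, (Y n).1 z := ((hsY z hz).tsum_eq_zero_add).symm
  change HasDerivAt _ (M z (v + ∑' n, (Y (n + 1)).1 z)) z
  rw [e, (M z).map_tsum (hsY z hz)]
  exact h

namespace SpecialKahlerStructure

variable {S : SpecialKahlerStructure} {z z₀ : ℂ}

theorem conj_connAnti_eq (hz : z ∈ puncturedDisc) :
    conj (S.connAnti z) = 2 * Complex.I * S.cubicCoeff z / S.dens z := by
  have : (S.dens z : ℂ) ≠ 0 := by exact_mod_cast (S.dens_pos z hz).ne'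
  rw [cubicCoeff_eq hz]
  field_simp
  linear_combination conj (S.connAnti z) * Complex.I_sq

/-- Since `d̄ = 2i Ξ₀ / dens` with `Ξ₀` holomorphic, only `dens` contributes to the `z̄`-derivative.
-/
theorem hasWirtingerAt_conj_connAnti (hz : z ∈ puncturedDisc)
    (hΞ : AnalyticAt ℂ S.cubicCoeff z) (h0 : S.cubicCoeff z ≠ 0) :
    HasWirtingerAt (fun w => conj (S.connAnti w))
      (conj (S.connAnti z) * (logDeriv S.cubicCoeff z - S.connHol z))
      (-(conj (S.connHol z) * conj (S.connAnti z))) z := by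
  have hdens : (S.dens z : ℂ) ≠ 0 := by exact_mod_cast (S.dens_pos z hz).ne'
  have h := (HasWirtingerAt.of_hasDerivAt
    (hΞ.differentiableAt.hasDerivAt.const_mul (2 * Complex.I))).div (hasWirtingerAt_dens hz) hdens
  have e : (fun w => conj (S.connAnti w)) =ᶠ[𝓝 z]
      fun w => 2 * Complex.I * S.cubicCoeff w / S.dens w := by
    filter_upwards [isOpen_puncturedDisc.mem_nhds hz] with w hw using conj_connAnti_eq hw
  refine HasWirtingerAt.congr (h.congr_of_eventuallyEq e) ?_ ?_
  · rw [conj_connAnti_eq hz, logDeriv_apply]; field_simp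
  · rw [conj_connAnti_eq hz]; field_simp; ring

variable (S) in
/-- The coefficient `Q` in the equation `p'' = Q p + (Ξ₀'/Ξ₀) p'` of flat holomorphic
differentials. -/
noncomputable def flatCoeff (z : ℂ) : ℂ :=
  S.connHolDeriv z + S.connHol z * S.connHol z - S.connHol z * logDeriv S.cubicCoeff z

theorem differentiableAt_logDeriv {f : ℂ → ℂ} (hf : AnalyticAt ℂ f z) (h0 : f z ≠ 0) :
    DifferentiableAt ℂ (logDeriv f) z :=
  hf.deriv.differentiableAt.div hf.differentiableAt h0

/-- By commuting mixed derivatives, `∂̄∂a = -∂(d d̄) = 2a|d|² - |d|² Ξ₀'/Ξ₀`. This cancels the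
`z̄`-derivatives of `a²` and `-a Ξ₀'/Ξ₀`. -/
theorem differentiableAt_flatCoeff (hz : z ∈ puncturedDisc)
    (hΞ : AnalyticAt ℂ S.cubicCoeff z) (h0 : S.cubicCoeff z ≠ 0) :
    DifferentiableAt ℂ S.flatCoeff z := by
  have hd := HasWirtingerAt.of_differentiableAt
    ((contDiffOn_connHolDeriv (S := S)).contDiffAt (isOpen_puncturedDisc.mem_nhds hz)
      |>.differentiableAt (by simp))
  have ha := hasWirtingerAt_connHol (S := S) hz
  have hc := hasWirtingerAt_conj_connAnti hz hΞ h0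
  have hB := (hc.conj_comp.mul hc).neg
  simp only [Complex.conj_conj] at hB
  have hm := HasWirtingerAt.mixed (eventually_of_mem (isOpen_puncturedDisc.mem_nhds hz)
    fun w hw => hasWirtingerAt_connHol (S := S) hw) hd hB
  have hQ := ((hd.congr rfl hm).add (ha.mul ha)).sub
    (ha.mul (.of_hasDerivAt (differentiableAt_logDeriv hΞ h0).hasDerivAt))
  refine (HasWirtingerAt.hasDerivAt (hQ.congr rfl ?_)).differentiableAt
  simp
  ring

/-- A solution of the second order equation of flat holomorphic differentials which solves the
flatness equation at one point solves it near that point. -/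
theorem flatness_of_second_order {p p₁ : ℂ → ℂ} {r K : ℝ}
    (hsub : Metric.ball z₀ r ⊆ puncturedDisc)
    (hΞ : ∀ z ∈ Metric.ball z₀ r, AnalyticAt ℂ S.cubicCoeff z ∧ S.cubicCoeff z ≠ 0)
    (hK : ∀ z ∈ Metric.ball z₀ r,
      ‖logDeriv S.cubicCoeff z - S.connHol z‖ + ‖S.connAnti z‖ ≤ K)
    (hp : ∀ z ∈ Metric.ball z₀ r, HasDerivAt p (p₁ z) z)
    (hp₁ : ∀ z ∈ Metric.ball z₀ r,
      HasDerivAt p₁ (S.flatCoeff z * p z + logDeriv S.cubicCoeff z * p₁ z) z)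
    (h0 : p₁ z₀ = S.connHol z₀ * p z₀ + conj (S.connAnti z₀) * conj (p z₀)) :
    ∀ z ∈ Metric.ball z₀ r,
      p₁ z = S.connHol z * p z + conj (S.connAnti z) * conj (p z) := by
  set e : ℂ → ℂ := fun w =>
    p₁ w - (S.connHol w * p w + conj (S.connAnti w) * conj (p w)) with he_def
  -- The defect `e` in the flatness equation satisfies a homogeneous first order linear system in
  -- `e` and `ē`.
  have he : ∀ z ∈ Metric.ball z₀ r, HasWirtingerAt e
      ((logDeriv S.cubicCoeff z - S.connHol z) * e z) (-conj (S.connAnti z) * conj (e z)) z := by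
    intro z hz
    have hW := HasWirtingerAt.of_hasDerivAt (hp z hz)
    have hc := hasWirtingerAt_conj_connAnti (hsub hz) (hΞ z hz).1 (hΞ z hz).2
    have h := (HasWirtingerAt.of_hasDerivAt (hp₁ z hz)).sub
      (((hasWirtingerAt_connHol (S := S) (hsub hz)).mul hW).add (hc.mul hW.conj_comp))
    refine h.congr ?_ ?_
    · simp only [he_def, flatCoeff, map_zero]; ring
    · simp only [he_def, map_sub, map_add, map_mul, Complex.conj_conj]; ring
  intro z hz
  set ζ := z - z₀ with hζ
  have hmem : ∀ t ∈ Set.Icc (0 : ℝ) 1, z₀ + t * ζ ∈ Metric.ball z₀ r := by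
    intro t ht
    rw [mem_ball_iff_norm] at hz ⊢
    rw [add_sub_cancel_left, norm_mul, Complex.norm_real, Real.norm_eq_abs, abs_of_nonneg ht.1]
    exact lt_of_le_of_lt (mul_le_of_le_one_left (norm_nonneg _) ht.2) hz
  have hd := fun t ht => (he _ (hmem t ht)).hasDerivAt_line
  -- Grönwall's inequality on the segment from `z₀` to `z`: the defect vanishes at `z₀` and its
  -- derivative is bounded by `K |ζ|` times itself.
  have hzero := eq_zero_of_abs_deriv_le_mul_abs_self_of_eq_zero_right (K := K * ‖ζ‖)
    (f := fun s : ℝ => e (z₀ + s * ζ)) (a := 0) (b := 1)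
    (fun t ht => (hd t ht).continuousAt.continuousWithinAt)
    (fun t ht => (hd t ⟨ht.1, ht.2.le⟩).hasDerivWithinAt) (by simp [he_def, h0])
    (fun t ht => by
      have hb := hK _ (hmem t ⟨ht.1, ht.2.le⟩)
      refine (norm_add_le _ _).trans ?_
      simp only [norm_mul, norm_neg, RCLike.norm_conj]
      calc _ = (‖logDeriv S.cubicCoeff (z₀ + t * ζ) - S.connHol (z₀ + t * ζ)‖
            + ‖S.connAnti (z₀ + t * ζ)‖) * ‖ζ‖ * ‖e (z₀ + t * ζ)‖ := by ring
        _ ≤ _ := by gcongr) 1 (by simp)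
  have : e z = 0 := by simpa [hζ] using hzero
  exact sub_eq_zero.1 this

/-- The pairing `p̄ q - p q̄` of two solutions of the flatness equation is a constant multiple of
the density of the metric. -/
theorem im_conj_mul_eq_dens {p q : ℂ → ℂ} {U : Set ℂ} (hU : IsOpen U) (hU' : IsPreconnected U)
    (hsub : U ⊆ puncturedDisc) (hz₀ : z₀ ∈ U)
    (hp : ∀ z ∈ U, HasDerivAt p (S.connHol z * p z + conj (S.connAnti z) * conj (p z)) z)
    (hq : ∀ z ∈ U, HasDerivAt q (S.connHol z * q z + conj (S.connAnti z) * conj (q z)) z)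
    (h0 : S.dens z₀ = (conj (p z₀) * q z₀).im) :
    ∀ z ∈ U, S.dens z = (conj (p z) * q z).im := by
  set F : ℂ → ℂ := fun w => (conj (p w) * q w - p w * conj (q w)) / S.dens w with hF_def
  have hne : ∀ z ∈ U, (S.dens z : ℂ) ≠ 0 := fun z hz => by
    exact_mod_cast (S.dens_pos z (hsub hz)).ne'
  -- The terms in `d̄` cancel in `∂(p̄ q - p q̄)`, so the numerator and `dens` both satisfy `∂f = a
  -- f`; the `z̄`-derivatives match in the same way.
  have hF : ∀ z ∈ U, HasWirtingerAt F 0 0 z := by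
    intro z hz
    have hP := HasWirtingerAt.of_hasDerivAt (hp z hz)
    have hQ := HasWirtingerAt.of_hasDerivAt (hq z hz)
    have h := ((hP.conj_comp.mul hQ).sub (hP.mul hQ.conj_comp)).div
      (hasWirtingerAt_dens (hsub hz)) (hne z hz)
    have := hne z hz
    refine h.congr ?_ ?_
    · simp only [map_zero]; field_simp; ring
    · simp only [map_add, map_mul, Complex.conj_conj]; field_simp; ring
  have hw : wirtinger 0 0 = 0 := by ext; simp
  have hval : ∀ z ∈ U, F z * S.dens z = 2 * Complex.I * (conj (p z) * q z).im := by
    intro z hz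
    have := Complex.sub_conj (conj (p z) * q z)
    rw [map_mul, Complex.conj_conj] at this
    rw [hF_def]; simp only
    rw [div_mul_cancel₀ _ (hne z hz), this]; push_cast; ring
  intro z hz
  have hconst : F z = F z₀ := hU.is_const_of_fderiv_eq_zero (𝕜 := ℝ) hU'
    (fun w hw => (HasFDerivAt.differentiableAt (hF w hw)).differentiableWithinAt)
    (fun w hw' => by rw [HasFDerivAt.fderiv (hF w hw'), hw]; rfl) hz hz₀
  have h1 := hval z₀ hz₀
  rw [← h0] at h1
  have hF2 : F z = 2 * Complex.I := hconst.trans (mul_right_cancel₀ (hne z₀ hz₀) h1)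
  have h2 := hval z hz
  rw [hF2] at h2
  exact_mod_cast mul_left_cancel₀ (by simp [Complex.I_ne_zero]) h2

/-- Conjugate special holomorphic coordinates exist near every point at which the cubic form is
holomorphic and does not vanish. -/
theorem exists_isConjugateSpecialPair (hz₀ : z₀ ∈ puncturedDisc)
    (hΞ : AnalyticAt ℂ S.cubicCoeff z₀) (h0 : S.cubicCoeff z₀ ≠ 0) :
    ∃ (U : Set ℂ) (Z W : ℂ → ℂ), z₀ ∈ U ∧ S.IsConjugateSpecialPair U Z W := by
  -- `M` is the companion matrix of `p'' = Q p + (Ξ₀'/Ξ₀) p'`, acting on `(p, p')`.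
  let c₁ : ℂ × ℂ →L[ℂ] ℂ × ℂ :=
    (ContinuousLinearMap.inl ℂ ℂ ℂ).comp (ContinuousLinearMap.snd ℂ ℂ ℂ)
  let c₂ : ℂ × ℂ →L[ℂ] ℂ × ℂ :=
    (ContinuousLinearMap.inr ℂ ℂ ℂ).comp (ContinuousLinearMap.fst ℂ ℂ ℂ)
  let c₃ : ℂ × ℂ →L[ℂ] ℂ × ℂ :=
    (ContinuousLinearMap.inr ℂ ℂ ℂ).comp (ContinuousLinearMap.snd ℂ ℂ ℂ)
  let M : ℂ → ℂ × ℂ →L[ℂ] ℂ × ℂ := fun z =>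
    c₁ + S.flatCoeff z • c₂ + logDeriv S.cubicCoeff z • c₃
  have hM : ∀ z ∈ puncturedDisc, AnalyticAt ℂ S.cubicCoeff z → S.cubicCoeff z ≠ 0 →
      DifferentiableAt ℂ M z := fun z hz h1 h2 =>
    ((differentiableAt_const _).add ((differentiableAt_flatCoeff hz h1 h2).smul_const _)).add
      ((differentiableAt_logDeriv h1 h2).smul_const _)
  let N : ℂ → ℝ := fun z => ‖logDeriv S.cubicCoeff z - S.connHol z‖ + ‖S.connAnti z‖
  have hN : ContinuousAt N z₀ := by
    have h1 := (contDiffOn_connHol (S := S)).contDiffAt (isOpen_puncturedDisc.mem_nhds hz₀)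
      |>.continuousAt
    have h2 := (contDiffOn_connAnti (S := S)).contDiffAt (isOpen_puncturedDisc.mem_nhds hz₀)
      |>.continuousAt
    exact ((differentiableAt_logDeriv hΞ h0).continuousAt.sub h1).norm.add h2.norm
  have hev : ∀ᶠ z in 𝓝 z₀, z ∈ puncturedDisc ∧ (AnalyticAt ℂ S.cubicCoeff z ∧
      S.cubicCoeff z ≠ 0) ∧ ‖M z‖ < ‖M z₀‖ + 1 ∧ N z < N z₀ + 1 := by
    filter_upwards [isOpen_puncturedDisc.mem_nhds hz₀, hΞ.eventually_analyticAt,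
      hΞ.continuousAt.eventually_ne h0,
      (hM z₀ hz₀ hΞ h0).continuousAt.norm.eventually_lt_const (lt_add_one _),
      hN.eventually_lt_const (lt_add_one _)] with z h1 h2 h3 h4 h5 using ⟨h1, ⟨h2, h3⟩, h4, h5⟩
  obtain ⟨R, hR, hball⟩ := Metric.eventually_nhds_iff_ball.1 hev
  set K := ‖M z₀‖ + 1 with hKdef
  have hKpos : 0 < K := by positivity
  obtain ⟨r, hr, hrR, hKr⟩ : ∃ r, 0 < r ∧ r ≤ R ∧ K * r < 1 := by
    refine ⟨min R (1 / (2 * K)), by positivity, min_le_left _ _, ?_⟩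
    calc K * min R (1 / (2 * K)) ≤ K * (1 / (2 * K)) := by gcongr; exact min_le_right _ _
      _ < 1 := by field_simp; norm_num
  have hB : ∀ z ∈ Metric.ball z₀ r, _ := fun z hz => hball z (Metric.ball_subset_ball hrR hz)
  have hsol : ∀ v : ℂ, ∃ P : ℂ → ℂ, ∃ p : ℂ → ℂ, p z₀ = v ∧
      (∀ z ∈ Metric.ball z₀ r, HasDerivAt P (p z) z) ∧
      ∀ z ∈ Metric.ball z₀ r,
        HasDerivAt p (S.connHol z * p z + conj (S.connAnti z) * conj (p z)) z := by
    intro v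
    obtain ⟨Y, hY0, hY⟩ := exists_hasDerivAt_linear hr
      (fun z hz => (hM z (hB z hz).1 (hB z hz).2.1.1
        (hB z hz).2.1.2).differentiableWithinAt) (fun z hz => (hB z hz).2.2.1.le) hKr
      -- The initial derivative is chosen so that the flatness equation holds at `z₀`.
      (v, S.connHol z₀ * v + conj (S.connAnti z₀) * conj v)
    have hY1 : ∀ z ∈ Metric.ball z₀ r, HasDerivAt (fun w => (Y w).1) (Y z).2 z := by
      intro z hz
      have := (ContinuousLinearMap.fst ℂ ℂ ℂ).hasFDerivAt.comp_hasDerivAt z (hY z hz)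
      simpa [M, c₁, c₂, c₃, Function.comp_def] using this
    have hY2 : ∀ z ∈ Metric.ball z₀ r, HasDerivAt (fun w => (Y w).2)
        (S.flatCoeff z * (Y z).1 + logDeriv S.cubicCoeff z * (Y z).2) z := by
      intro z hz
      have := (ContinuousLinearMap.snd ℂ ℂ ℂ).hasFDerivAt.comp_hasDerivAt z (hY z hz)
      simpa [M, c₁, c₂, c₃, Function.comp_def] using this
    have hflat := flatness_of_second_order (fun z hz => (hB z hz).1)
      (fun z hz => (hB z hz).2.1) (fun z hz => (hB z hz).2.2.2.le) hY1 hY2 (by simp [hY0])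
    have hY3 : ∀ z ∈ Metric.ball z₀ r, HasDerivAt (fun w => (Y w).1)
        (S.connHol z * (Y z).1 + conj (S.connAnti z) * conj (Y z).1) z := fun z hz => by
      rw [← hflat z hz]; exact hY1 z hz
    obtain ⟨P, hP⟩ := DifferentiableOn.isExactOn_ball (c := z₀) (r := r)
      (f := fun w => (Y w).1) fun z hz => (hY1 z hz).differentiableAt.differentiableWithinAt
    exact ⟨P, fun w => (Y w).1, by simp [hY0], hP, hY3⟩
  -- The initial values `1` and `i dens(z₀)` make `Im (p̄ q) = dens` at `z₀`, which is the Darboux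
  -- condition there.
  obtain ⟨Z, p, hp0, hZ, hp⟩ := hsol 1
  obtain ⟨W, q, hq0, hW, hq⟩ := hsol (Complex.I * S.dens z₀)
  have hsub : Metric.ball z₀ r ⊆ puncturedDisc := fun z hz => (hB z hz).1
  have hdens := im_conj_mul_eq_dens Metric.isOpen_ball (convex_ball z₀ r).isPreconnected hsub
    (Metric.mem_ball_self hr) hp hq (by simp [hp0, hq0])
  exact ⟨Metric.ball z₀ r, Z, W, Metric.mem_ball_self hr,
    { isOpen := Metric.isOpen_ball
      subset := hsub
      holo_Z := fun z hz => (hZ z hz).differentiableAt.differentiableWithinAt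
      holo_W := fun z hz => (hW z hz).differentiableAt.differentiableWithinAt
      flat_Z := (isFlatFunction_re_iff Metric.isOpen_ball hsub hZ hp).2 fun _ _ => rfl
      flat_W := (isFlatFunction_re_iff Metric.isOpen_ball hsub hW hq).2 fun _ _ => rfl
      darboux := fun z hz => (darboux_iff (hZ z hz) (hW z hz)).2 (hdens z hz) }⟩

end SpecialKahlerStructure

/-! ### Laplacians, the maximum principle and barrier arguments at the puncture -/

/-- `f` is differentiable near `z`, its gradient is differentiable at `z`, and its Laplacian at `z`
equals `s`. The gradient is recorded by the function `G = f_x - i f_y`. -/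
def HasLaplacianAt (f : ℂ → ℝ) (s : ℝ) (z : ℂ) : Prop :=
  ∃ (G : ℂ → ℂ) (α β : ℂ), (∀ᶠ w in 𝓝 z, HasWirtingerAt (fun v => (f v : ℂ)) (G w / 2)
    (conj (G w) / 2) w) ∧ HasWirtingerAt G α β z ∧ s = 2 * β.re

namespace HasLaplacianAt

variable {f g : ℂ → ℝ} {s s' : ℝ} {z : ℂ}

theorem continuousAt (h : HasLaplacianAt f s z) : ContinuousAt f z := by
  obtain ⟨G, α, β, h1, -, -⟩ := h
  have := Complex.continuous_re.continuousAt.comp (HasFDerivAt.continuousAt h1.self_of_nhds)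
  simpa [Function.comp_def] using this

theorem add (hf : HasLaplacianAt f s z) (hg : HasLaplacianAt g s' z) :
    HasLaplacianAt (fun w => f w + g w) (s + s') z := by
  obtain ⟨G, α, β, h1, h2, h3⟩ := hf
  obtain ⟨G', α', β', h1', h2', h3'⟩ := hg
  refine ⟨fun w => G w + G' w, α + α', β + β', ?_, h2.add h2', by rw [h3, h3']; simp; ring⟩
  filter_upwards [h1, h1'] with w hw hw'
  have := HasWirtingerAt.add hw hw'
  simp only [← Complex.ofReal_add] at this
  exact HasWirtingerAt.congr this (by ring) (by rw [map_add]; ring)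

theorem const_mul (c : ℝ) (hf : HasLaplacianAt f s z) :
    HasLaplacianAt (fun w => c * f w) (c * s) z := by
  obtain ⟨G, α, β, h1, h2, h3⟩ := hf
  have hc : ∀ w, HasWirtingerAt (fun _ => (c : ℂ)) 0 0 w := fun w =>
    .of_hasDerivAt (hasDerivAt_const w _)
  refine ⟨fun w => c * G w, _, _, ?_, (hc z).mul h2, by rw [h3]; simp; ring⟩
  filter_upwards [h1] with w hw
  have := (hc w).mul hw
  simp only [← Complex.ofReal_mul] at this
  exact HasWirtingerAt.congr this (by ring) (by rw [map_mul, Complex.conj_ofReal]; ring)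

theorem const (c : ℝ) (z : ℂ) : HasLaplacianAt (fun _ => c) 0 z :=
  ⟨fun _ => 0, 0, 0, .of_forall fun w => by
    simpa using HasWirtingerAt.of_hasDerivAt (hasDerivAt_const w (c : ℂ)),
    .of_hasDerivAt (hasDerivAt_const z _), by simp⟩

theorem norm_sq (z : ℂ) : HasLaplacianAt (fun w => ‖w‖ ^ 2) 4 z := by
  have hid : ∀ w : ℂ, HasWirtingerAt (fun v => v) 1 0 w := fun w => .of_hasDerivAt (hasDerivAt_id w)
  have h2 : ∀ w : ℂ, HasWirtingerAt (fun _ => (2 : ℂ)) 0 0 w := fun w =>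
    .of_hasDerivAt (hasDerivAt_const w _)
  refine ⟨fun w => 2 * conj w, _, _, .of_forall fun w => ?_, (h2 z).mul (hid z).conj_comp, ?_⟩
  · have e : (fun v : ℂ => ((‖v‖ ^ 2 : ℝ) : ℂ)) = fun v => v * conj v := by
      ext v; rw [Complex.mul_conj, Complex.normSq_eq_norm_sq]
    rw [e]
    exact ((hid w).mul (hid w).conj_comp).congr (by simp) (by simp [Complex.conj_ofNat])
  · norm_num

theorem hasWirtingerAt_log {f : ℂ → ℝ} {α : ℂ} (hz : f z ≠ 0)
    (h : HasWirtingerAt (fun w => (f w : ℂ)) α (starRingEnd ℂ α) z) :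
    HasWirtingerAt (fun w => (Real.log (f w) : ℂ)) (α / f z) (starRingEnd ℂ (α / f z)) z := by
  have hre : HasFDerivAt f _ z := Complex.reCLM.hasFDerivAt.comp z h
  refine .of_hasFDerivAt (Complex.ofRealCLM.hasFDerivAt.comp z (hre.log hz)) fun X => ?_
  have : ((Complex.re (α * X + conj α * conj X) : ℝ) : ℂ) = α * X + conj α * conj X := by
    rw [← map_mul, Complex.add_conj]; simp
  simp only [ContinuousLinearMap.comp_apply, smul_apply, wirtinger_apply,
    Complex.reCLM_apply, Complex.ofRealCLM_apply, smul_eq_mul, Complex.ofReal_mul, this,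
    map_div₀, Complex.conj_ofReal, Complex.ofReal_inv]
  ring

theorem hasWirtingerAt_log_norm (hz : z ≠ 0) :
    HasWirtingerAt (fun w => (Real.log ‖w‖ : ℂ)) (1 / z / 2) (conj (1 / z) / 2) z := by
  have hid : ∀ w : ℂ, HasWirtingerAt (fun v => v) 1 0 w := fun w => .of_hasDerivAt (hasDerivAt_id w)
  have e : (fun v : ℂ => ((‖v‖ ^ 2 : ℝ) : ℂ)) = fun v => v * conj v := by
    ext v; rw [Complex.mul_conj, Complex.normSq_eq_norm_sq]
  have h1 : HasWirtingerAt (fun v : ℂ => ((‖v‖ ^ 2 : ℝ) : ℂ)) (conj z) (starRingEnd ℂ (conj z))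
      z := by
    rw [e]
    exact ((hid z).mul (hid z).conj_comp).congr (by simp) (by simp)
  have h2 := (HasWirtingerAt.of_hasDerivAt (hasDerivAt_const z (1 / 2 : ℂ))).mul
    (hasWirtingerAt_log (by simpa using hz) h1)
  have e2 : (fun w : ℂ => (Real.log ‖w‖ : ℂ))
      = fun w => (1 / 2 : ℂ) * ((Real.log (‖w‖ ^ 2) : ℝ) : ℂ) := by
    ext w; rw [Real.log_pow]; push_cast; ring
  have e3 : ((‖z‖ ^ 2 : ℝ) : ℂ) = z * conj z := congrFun e z
  rw [e2]
  have hz' : conj z ≠ 0 := by simpa using hz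
  refine h2.congr ?_ ?_
  · rw [e3]; field_simp; simp
  · rw [e3]
    simp only [map_div₀, map_mul, Complex.conj_conj, map_one]
    field_simp; simp

theorem log_norm (hz : z ≠ 0) : HasLaplacianAt (fun w => Real.log ‖w‖) 0 z := by
  refine ⟨fun w => 1 / w, -1 / z ^ 2, 0, ?_, ?_, by simp⟩
  · filter_upwards [isOpen_ne.mem_nhds hz] with w hw using hasWirtingerAt_log_norm hw
  · simp only [one_div]
    exact .of_hasDerivAt (by simpa [neg_div] using hasDerivAt_inv hz)

/-- On functions of `t = log r` the Laplacian is `r⁻² d²/dt²`. Quadratic polynomials in `t`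
therefore serve as barriers against a Laplacian of size `r⁻²`. -/
theorem log_norm_sq (hz : z ≠ 0) :
    HasLaplacianAt (fun w => Real.log ‖w‖ ^ 2) (2 / ‖z‖ ^ 2) z := by
  have hinv : HasWirtingerAt (fun w : ℂ => w⁻¹) (-1 / z ^ 2) 0 z :=
    .of_hasDerivAt (by simpa [neg_div] using hasDerivAt_inv hz)
  refine ⟨fun w => 2 * (Real.log ‖w‖ * w⁻¹), _, _, ?_,
    (HasWirtingerAt.of_hasDerivAt (hasDerivAt_const z (2 : ℂ))).mul
      ((hasWirtingerAt_log_norm hz).mul hinv), ?_⟩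
  · filter_upwards [isOpen_ne.mem_nhds hz] with w hw
    have h := (hasWirtingerAt_log_norm hw).mul (hasWirtingerAt_log_norm hw)
    simp only [← pow_two, ← Complex.ofReal_pow] at h
    refine HasWirtingerAt.congr h (by ring) ?_
    simp only [map_mul, map_one, map_div₀, map_inv₀, Complex.conj_ofReal, Complex.conj_ofNat]
    ring
  · have hzz : (z * conj z : ℂ) = ((‖z‖ ^ 2 : ℝ) : ℂ) := by
      rw [Complex.mul_conj, Complex.normSq_eq_norm_sq]
    have hz' : conj z ≠ 0 := by simpa using hz
    have : (2 : ℂ) * ((conj (1 / z) / 2) * z⁻¹) = ((1 / ‖z‖ ^ 2 : ℝ) : ℂ) := by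
      rw [Complex.ofReal_div, ← hzz]
      simp only [map_div₀, map_one]
      field_simp
      simp
    simp only [zero_mul, zero_add, mul_zero, add_zero]
    rw [this, Complex.ofReal_re]; ring

/-- A function has no local maximum at a point where its Laplacian is positive. -/
theorem not_isLocalMax (h : HasLaplacianAt f s z) (hs : 0 < s) : ¬ IsLocalMax f z := by
  intro hmax
  obtain ⟨G, α, β, h1, h2, h3⟩ := h
  -- The expression is the second derivative of `f` in direction `e`. If it were positive, the point
  -- would also be a local minimum along the line, so `f` would be locally constant there, with
  -- second derivative zero.
  have key : ∀ e : ℂ, ((α * e + β * conj e) * e).re ≤ 0 := by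
    intro e
    by_contra! hpos
    set φ : ℝ → ℝ := fun t => f (z + t * e)
    have hline : Tendsto (fun t : ℝ => z + (t : ℂ) * e) (𝓝 0) (𝓝 z) := by
      have : Continuous fun t : ℝ => z + (t : ℂ) * e := by fun_prop
      simpa using this.tendsto 0
    have hd : ∀ᶠ t : ℝ in 𝓝 0, HasDerivAt φ (G (z + t * e) * e).re t := by
      filter_upwards [hline.eventually h1] with t ht
      have := Complex.reCLM.hasFDerivAt.comp_hasDerivAt t (HasWirtingerAt.hasDerivAt_line ht)
      have e2 : Complex.reCLM (G (z + t * e) / 2 * e + conj (G (z + t * e)) / 2 * conj e)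
          = (G (z + t * e) * e).re := by
        rw [div_mul_eq_mul_div, div_mul_eq_mul_div, ← map_mul, ← add_div, Complex.add_conj]
        simp
      rw [e2] at this
      simpa [φ, Function.comp_def] using this
    have hdd : deriv (deriv φ) 0 = ((α * e + β * conj e) * e).re := by
      have e1 : deriv φ =ᶠ[𝓝 0] fun t => (G (z + t * e) * e).re := by
        filter_upwards [hd] with t ht using ht.deriv
      rw [e1.deriv_eq]
      have h2' : HasWirtingerAt G α β (z + ((0 : ℝ) : ℂ) * e) := by simpa using h2
      exact (Complex.reCLM.hasFDerivAt.comp_hasDerivAt (0 : ℝ)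
        (h2'.hasDerivAt_line.mul_const e)).deriv
    have hφmax : IsLocalMax φ 0 := by
      filter_upwards [hline.eventually hmax] with t ht
      simpa [φ] using ht
    have hφmin : IsLocalMin φ 0 := isLocalMin_of_deriv_deriv_pos (by rw [hdd]; exact hpos)
      hφmax.deriv_eq_zero hd.self_of_nhds.continuousAt
    have hconst : φ =ᶠ[𝓝 0] fun _ => φ 0 := by
      filter_upwards [hφmax, hφmin] with t h1 h2 using le_antisymm h1 h2
    have : deriv (deriv φ) 0 = 0 := by
      rw [hconst.deriv.deriv_eq]; simp
    rw [hdd] at this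
    linarith
  -- Adding the second derivatives in the directions `1` and `i` gives the Laplacian `2 Re β`.
  have k1 := key 1
  have k2 := key Complex.I
  simp at k1 k2
  linarith

/-- The maximum principle on an annulus. -/
theorem le_of_annulus {r₁ r₂ B : ℝ} (σ : ℂ → ℝ)
    (hlap : ∀ z, r₁ ≤ ‖z‖ → ‖z‖ ≤ r₂ → HasLaplacianAt f (σ z) z)
    (hσ : ∀ z, r₁ ≤ ‖z‖ → ‖z‖ ≤ r₂ → 0 < σ z)
    (h₁ : ∀ z, ‖z‖ = r₁ → f z ≤ B) (h₂ : ∀ z, ‖z‖ = r₂ → f z ≤ B)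
    (hz₁ : r₁ ≤ ‖z‖) (hz₂ : ‖z‖ ≤ r₂) : f z ≤ B := by
  set A : Set ℂ := {w | r₁ ≤ ‖w‖} ∩ {w | ‖w‖ ≤ r₂}
  have hA : IsCompact A := Metric.isCompact_of_isClosed_isBounded
    ((isClosed_le continuous_const continuous_norm).inter
      (isClosed_le continuous_norm continuous_const))
    ((Metric.isBounded_closedBall (x := (0 : ℂ)) (r := r₂)).subset fun w hw => by
      simpa using hw.2)
  obtain ⟨w, hw, hmax⟩ := hA.exists_isMaxOn ⟨z, hz₁, hz₂⟩
    (fun w hw => (hlap w hw.1 hw.2).continuousAt.continuousWithinAt)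
  refine (hmax ⟨hz₁, hz₂⟩).trans ?_
  rcases eq_or_lt_of_le (show r₁ ≤ ‖w‖ from hw.1) with h | h
  · exact h₁ w h.symm
  rcases eq_or_lt_of_le (show ‖w‖ ≤ r₂ from hw.2) with h' | h'
  · exact h₂ w h'
  have hnhds : A ∈ 𝓝 w := by
    filter_upwards [(isOpen_lt continuous_const continuous_norm).mem_nhds h,
      (isOpen_lt continuous_norm continuous_const).mem_nhds h'] with v hv hv'
      using ⟨le_of_lt hv, le_of_lt hv'⟩
  exact absurd (hmax.isLocalMax hnhds) ((hlap w hw.1 hw.2).not_isLocalMax (hσ w hw.1 hw.2))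

/-- A function on a punctured disc which is bounded above and has at most logarithmic growth does
not have Laplacian at least `c / |z|²` with `c > 0`. -/
theorem false_of_ge_div_norm_sq {σ : ℂ → ℝ} {c B : ℝ} (hc : 0 < c)
    (hlap : ∀ᶠ z in 𝓝[≠] 0, HasLaplacianAt f (σ z) z)
    (hσ : ∀ᶠ z in 𝓝[≠] 0, c / ‖z‖ ^ 2 ≤ σ z)
    (hle : ∀ᶠ z in 𝓝[≠] 0, f z ≤ B) (hge : ∀ᶠ z in 𝓝[≠] 0, Real.log ‖z‖ - B ≤ f z) : False := by
  have hev := ((hlap.and hσ).and (hle.and hge))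
  rw [eventually_nhdsWithin_iff, Metric.eventually_nhds_iff_ball] at hev
  obtain ⟨δ, hδ, H⟩ := hev
  have H' : ∀ z : ℂ, 0 < ‖z‖ → ‖z‖ < δ → _ := fun z h1 h2 =>
    H z (by simpa using h2) (by simpa using h1)
  set L₂ := Real.log (δ / 2) with hL₂
  set C := 2 * B - L₂
  -- The barrier will yield `c d² / 16 ≤ C + d / 2`; this `d` is large enough to violate it.
  set d := 16 / c * (|C| + 1) + 1 with hd
  have hd1 : 1 ≤ d := by rw [hd]; have : 0 ≤ 16 / c * (|C| + 1) := by positivity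
                         linarith
  set L₁ := L₂ - d with hL₁
  have hexp : Real.exp L₂ = δ / 2 := Real.exp_log (by positivity)
  have hrange : ∀ z : ℂ, Real.exp L₁ ≤ ‖z‖ → ‖z‖ ≤ Real.exp L₂ → 0 < ‖z‖ ∧ ‖z‖ < δ := by
    intro z h1 h2
    exact ⟨(Real.exp_pos _).trans_le h1, by rw [hexp] at h2; linarith⟩
  have hnorm : ‖(Real.exp (L₂ - d / 2) : ℂ)‖ = Real.exp (L₂ - d / 2) := by
    rw [Complex.norm_real, Real.norm_of_nonneg (Real.exp_pos _).le]
  -- With `t = log |w|`, subtract `(c/4)(t - L₁)(t - L₂)`: it vanishes on both boundary circles, its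
  -- Laplacian is `c / (2|w|²)`, and at the midpoint `t = L₂ - d/2` it equals `-c d² / 16`.
  have hmain := le_of_annulus (z := (Real.exp (L₂ - d / 2) : ℂ)) (r₁ := Real.exp L₁)
    (r₂ := Real.exp L₂) (B := B)
    (f := fun w => f w + (-(c / 4)) * (Real.log ‖w‖ ^ 2 + (-(L₁ + L₂) * Real.log ‖w‖ + L₁ * L₂)))
    (fun w => σ w + (-(c / 4)) * (2 / ‖w‖ ^ 2 + (-(L₁ + L₂) * 0 + 0)))
    (fun w h1 h2 => by
      obtain ⟨h3, h4⟩ := hrange w h1 h2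
      have hw : w ≠ 0 := norm_pos_iff.1 h3
      exact (H' w h3 h4).1.1.add
        (((log_norm_sq hw).add (((log_norm hw).const_mul _).add (const _ w))).const_mul _))
    (fun w h1 h2 => by
      obtain ⟨h3, h4⟩ := hrange w h1 h2
      have h5 := (H' w h3 h4).1.2
      have h6 : 0 < c / ‖w‖ ^ 2 := by positivity
      have : (-(c / 4)) * (2 / ‖w‖ ^ 2 + (-(L₁ + L₂) * 0 + 0)) = -(c / ‖w‖ ^ 2) / 2 := by ring
      rw [this]; linarith)
    (fun w hw => by
      obtain ⟨h3, h4⟩ := hrange w hw.ge (hw.le.trans (Real.exp_le_exp.2 (by linarith)))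
      have := (H' w h3 h4).2.1
      simp only [hw, Real.log_exp]; ring_nf; linarith)
    (fun w hw => by
      obtain ⟨h3, h4⟩ := hrange w (le_trans (Real.exp_le_exp.2 (by linarith)) hw.ge) hw.le
      have := (H' w h3 h4).2.1
      simp only [hw, Real.log_exp]; ring_nf; linarith)
    (by rw [hnorm, Real.exp_le_exp]; linarith)
    (by rw [hnorm, Real.exp_le_exp]; linarith)
  have hlow : L₂ - d / 2 - B ≤ f (Real.exp (L₂ - d / 2) : ℂ) := by
    obtain ⟨h3, h4⟩ := hrange (Real.exp (L₂ - d / 2) : ℂ)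
      (by rw [hnorm, Real.exp_le_exp]; linarith) (by rw [hnorm, Real.exp_le_exp]; linarith)
    have := (H' _ h3 h4).2.2
    rwa [hnorm, Real.log_exp] at this
  simp only [hnorm, Real.log_exp] at hmain
  have h1 : c / 16 * d * d ≤ C + d / 2 := by
    rw [hL₁] at hmain
    simp only [C]
    linarith
  have h2 : c / 16 * d = |C| + 1 + c / 16 := by rw [hd]; field_simp
  rw [h2] at h1
  have h3 : |C| ≤ |C| * d := le_mul_of_one_le_right (abs_nonneg _) hd1
  have h4 : 0 < c / 16 * d := by positivity
  linarith [le_abs_self C]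

/-- A function on a punctured disc which tends to `-∞` at the puncture, more slowly than the
logarithm, does not have bounded Laplacian. -/
theorem false_of_le {σ : ℂ → ℝ} {M : ℝ} (hM : 0 < M)
    (hlap : ∀ᶠ z in 𝓝[≠] 0, HasLaplacianAt f (σ z) z)
    (hσ : ∀ᶠ z in 𝓝[≠] 0, σ z ≤ M) (hbot : Tendsto f (𝓝[≠] 0) atBot)
    (hge : ∀ ε > 0, ∀ᶠ z in 𝓝[≠] 0, ε * Real.log ‖z‖ ≤ f z) : False := by
  have hL : Tendsto (fun z : ℂ => Real.log ‖z‖) (𝓝[≠] 0) atBot :=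
    Real.tendsto_log_nhdsGT_zero.comp tendsto_norm_nhdsNE_zero
  have hev := hlap.and hσ
  rw [eventually_nhdsWithin_iff, Metric.eventually_nhds_iff_ball] at hev
  obtain ⟨δ, hδ, H⟩ := hev
  have H' : ∀ z : ℂ, 0 < ‖z‖ → ‖z‖ < δ → _ := fun z h1 h2 =>
    H z (by simpa using h2) (by simpa using h1)
  obtain ⟨r₀, hr₀, hr₀δ, hr₀1⟩ : ∃ r₀, 0 < r₀ ∧ r₀ < δ ∧ r₀ ≤ 1 :=
    ⟨min (δ / 2) 1, by positivity, (min_le_left _ _).trans_lt (by linarith), min_le_right _ _⟩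
  have hcont : ContinuousOn f (Metric.sphere 0 r₀) := fun w hw => by
    have hw' : ‖w‖ = r₀ := by simpa using hw
    exact (H' w (hw' ▸ hr₀) (hw' ▸ hr₀δ)).1.continuousAt.continuousWithinAt
  obtain ⟨m, hm⟩ := (isCompact_sphere (0 : ℂ) r₀).bddBelow_image hcont
  have hm' : ∀ w, ‖w‖ = r₀ → m ≤ f w := fun w hw => hm ⟨w, by simpa using hw, rfl⟩
  have hsq : ∀ w : ℂ, ‖w‖ ≤ r₀ → M * ‖w‖ ^ 2 ≤ M := fun w hw =>
    mul_le_of_le_one_right hM.le (pow_le_one₀ (norm_nonneg _) (hw.trans hr₀1))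
  have hlog : ∀ w : ℂ, ‖w‖ ≤ r₀ → Real.log ‖w‖ ≤ 0 := fun w hw =>
    Real.log_nonpos (norm_nonneg _) (hw.trans hr₀1)
  set C := M + |m| with hC
  have key : ∀ z : ℂ, 0 < ‖z‖ → ‖z‖ ≤ r₀ → ∀ ε > 0, -f z + ε * Real.log ‖z‖ ≤ C := by
    intro z hz hzr ε hε
    -- With `ε/2` here, `-f + ε log r ≤ (ε/2) log r` near the puncture, which is very negative on a
    -- small inner circle.
    have hev2 := (hge (ε / 2) (by positivity)).and
      (hL.eventually_le_atBot ((C - M) / (ε / 2)))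
    rw [eventually_nhdsWithin_iff, Metric.eventually_nhds_iff_ball] at hev2
    obtain ⟨δ₁, hδ₁, H₁⟩ := hev2
    obtain ⟨r₁, hr₁, hr₁δ, hr₁z⟩ : ∃ r₁, 0 < r₁ ∧ r₁ < δ₁ ∧ r₁ ≤ ‖z‖ :=
      ⟨min (δ₁ / 2) ‖z‖, by positivity, (min_le_left _ _).trans_lt (by linarith), min_le_right _ _⟩
    -- The term `M |w|²` contributes `4M`, which outweighs `σ ≤ M` and makes the Laplacian strictly
    -- positive; `ε log |w|` is harmonic and controls the inner circle.
    have hmain := le_of_annulus (z := z) (r₁ := r₁) (r₂ := r₀) (B := C)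
      (f := fun w => M * ‖w‖ ^ 2 + ((-1) * f w + ε * Real.log ‖w‖))
      (fun w => M * 4 + ((-1) * σ w + ε * 0))
      (fun w h1 h2 => by
        have hw : 0 < ‖w‖ := hr₁.trans_le h1
        exact ((norm_sq w).const_mul M).add (((H' w hw (h2.trans_lt hr₀δ)).1.const_mul _).add
          ((log_norm (norm_pos_iff.1 hw)).const_mul _)))
      (fun w h1 h2 => by
        have := (H' w (hr₁.trans_le h1) (h2.trans_lt hr₀δ)).2
        linarith)
      (fun w hw => by
        have hwr : ‖w‖ ≤ r₀ := hw.le.trans (hr₁z.trans hzr)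
        obtain ⟨h1, h2⟩ := H₁ w (by simpa [hw] using hr₁δ)
          (by simpa using norm_pos_iff.1 (hw ▸ hr₁))
        rw [le_div_iff₀ (by positivity)] at h2
        linarith [hsq w hwr])
      (fun w hw => by
        have h1 := mul_nonpos_of_nonneg_of_nonpos hε.le (hlog w hw.le)
        linarith [hsq w hw.le, hm' w hw, neg_abs_le m])
      hr₁z hzr
    have : 0 ≤ M * ‖z‖ ^ 2 := by positivity
    linarith
  have key2 : ∀ z : ℂ, 0 < ‖z‖ → ‖z‖ ≤ r₀ → -f z ≤ C := by
    intro z hz hzr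
    refine le_of_forall_pos_le_add fun ε hε => ?_
    -- The coefficient of `log ‖z‖` is taken so small that its contribution at this fixed `z` is at
    -- most `ε`.
    have h := key z hz hzr (ε / (|Real.log ‖z‖| + 1)) (by positivity)
    have h1 : ε / (|Real.log ‖z‖| + 1) * -Real.log ‖z‖ ≤ ε := by
      rw [div_mul_eq_mul_div, div_le_iff₀ (by positivity)]
      gcongr
      linarith [neg_le_abs (Real.log ‖z‖)]
    linarith
  have hsmall : ∀ᶠ z : ℂ in 𝓝[≠] 0, 0 < ‖z‖ ∧ ‖z‖ ≤ r₀ := by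
    rw [eventually_nhdsWithin_iff, Metric.eventually_nhds_iff_ball]
    exact ⟨r₀, hr₀, fun z hz h0 => ⟨by simpa using h0, by simpa using (Metric.mem_ball.1 hz).le⟩⟩
  obtain ⟨z, ⟨hz1, hz2⟩, hz3⟩ := (hsmall.and (hbot.eventually_lt_atBot (-C))).exists
  linarith [key2 z hz1 hz2]

end HasLaplacianAt

/-! ### Asymptotics of the two metrics at the puncture -/

theorem tendsto_log_norm_nhdsNE : Tendsto (fun z : ℂ => Real.log ‖z‖) (𝓝[≠] 0) atBot :=
  Real.tendsto_log_nhdsGT_zero.comp tendsto_norm_nhdsNE_zero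

theorem eventually_mem_puncturedDisc : ∀ᶠ z in 𝓝[≠] 0, z ∈ puncturedDisc := by
  rw [eventually_nhdsWithin_iff]
  filter_upwards [Metric.ball_mem_nhds (0 : ℂ) one_pos] with z hz h0
  exact ⟨by simpa using h0, by simpa using hz⟩

/-- If `E = 16 A² / D²` with `A` converging to a positive limit, then `D` has a positive limit if
and only if `E` has one. -/
theorem exists_tendsto_pos_iff {ι : Type*} {l : Filter ι} {A D E : ι → ℝ} {a : ℝ}
    (hA : Tendsto A l (𝓝 a)) (ha : 0 < a) (hD : ∀ᶠ i in l, 0 < D i)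
    (hE : ∀ᶠ i in l, E i = 16 * A i ^ 2 / D i ^ 2) :
    (∃ C : ℝ, 0 < C ∧ Tendsto D l (𝓝 C)) ↔ ∃ C : ℝ, 0 < C ∧ Tendsto E l (𝓝 C) := by
  constructor
  · rintro ⟨C, hC, h⟩
    refine ⟨16 * a ^ 2 / C ^ 2, by positivity, ?_⟩
    exact (((hA.pow 2).const_mul 16).div (h.pow 2) (by positivity)).congr'
      (hE.mono fun i hi => hi.symm)
  · rintro ⟨C, hC, h⟩
    refine ⟨4 * a / Real.sqrt C, by positivity, ?_⟩
    refine ((hA.const_mul 4).div h.sqrt (by positivity)).congr' ?_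
    filter_upwards [hE, hD, hA.eventually_const_lt ha] with i h1 h2 h3
    have : E i = (4 * A i / D i) ^ 2 := by rw [h1]; ring
    simp only [Pi.div_apply]
    rw [this, Real.sqrt_sq (by positivity)]
    field_simp

namespace SpecialKahlerStructure

variable {S : SpecialKahlerStructure} {n : ℤ} {z : ℂ}

theorem tendsto_norm_cubicCoeff_div (hmero : MeromorphicAt S.cubicCoeff 0)
    (hord : meromorphicOrderAt S.cubicCoeff 0 = (n : WithTop ℤ)) :
    ∃ a : ℝ, 0 < a ∧
      Tendsto (fun z => ‖S.cubicCoeff z‖ / ‖z‖ ^ (n : ℝ)) (𝓝[≠] 0) (𝓝 a) := by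
  obtain ⟨g, hg, hg0, h⟩ := (meromorphicOrderAt_eq_int_iff hmero).1 hord
  refine ⟨‖g 0‖, norm_pos_iff.2 hg0,
    (hg.continuousAt.norm.tendsto.mono_left nhdsWithin_le_nhds).congr' ?_⟩
  filter_upwards [h, self_mem_nhdsWithin] with z hz h0
  have : ‖z‖ ^ n ≠ 0 := zpow_ne_zero _ (norm_ne_zero_iff.2 h0)
  rw [hz, sub_zero, norm_smul, norm_zpow, Real.rpow_intCast]
  field_simp

theorem eventually_cubicCoeff (hmero : MeromorphicAt S.cubicCoeff 0)
    (hord : meromorphicOrderAt S.cubicCoeff 0 = (n : WithTop ℤ)) :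
    ∀ᶠ z in 𝓝[≠] 0, AnalyticAt ℂ S.cubicCoeff z ∧ S.cubicCoeff z ≠ 0 := by
  obtain ⟨g, hg, hg0, h⟩ := (meromorphicOrderAt_eq_int_iff hmero).1 hord
  filter_upwards [hmero.eventually_analyticAt, h, self_mem_nhdsWithin,
    (hg.continuousAt.eventually_ne hg0).filter_mono nhdsWithin_le_nhds] with z h1 h2 h3 h4
  refine ⟨h1, ?_⟩
  rw [h2, sub_zero]
  exact smul_ne_zero (zpow_ne_zero _ h3) h4

theorem eventually_hypDens_eq (hmero : MeromorphicAt S.cubicCoeff 0)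
    (hord : meromorphicOrderAt S.cubicCoeff 0 = (n : WithTop ℤ)) :
    ∀ᶠ z in 𝓝[≠] 0, S.hypDens z = 16 * ‖S.cubicCoeff z‖ ^ 2 / S.dens z ^ 2 := by
  filter_upwards [eventually_cubicCoeff hmero hord, eventually_mem_puncturedDisc] with z h1 h2
    using hypDens_eq (exists_isConjugateSpecialPair h2 h1.1 h1.2)

/-- The Liouville equation for the density of the metric. -/
theorem hasLaplacianAt_log_dens (hz : z ∈ puncturedDisc) :
    HasLaplacianAt (fun w => Real.log (S.dens w))
      (-(16 * ‖S.cubicCoeff z‖ ^ 2 / S.dens z ^ 2)) z := by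
  have hpos := S.dens_pos z hz
  refine ⟨fun w => 2 * S.connHol w, _, _, ?_,
    (HasWirtingerAt.of_hasDerivAt (hasDerivAt_const z (2 : ℂ))).mul (hasWirtingerAt_connHol hz), ?_⟩
  · filter_upwards [isOpen_puncturedDisc.mem_nhds hz] with w hw
    have h0 := (S.dens_pos w hw).ne'
    have h0' : (S.dens w : ℂ) ≠ 0 := by exact_mod_cast h0
    have := HasLaplacianAt.hasWirtingerAt_log h0
      ((hasWirtingerAt_dens hw).congr rfl (by rw [map_mul, Complex.conj_ofReal]))
    refine HasWirtingerAt.congr this (by field_simp) ?_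
    rw [mul_div_cancel_left₀ _ h0', map_mul, Complex.conj_ofNat]
    ring
  · rw [norm_sq_cubicCoeff hz, Complex.mul_conj, Complex.normSq_eq_norm_sq]
    simp only [zero_mul, zero_add, ← Complex.ofReal_neg]
    rw [← Complex.ofReal_ofNat, ← Complex.ofReal_mul, Complex.ofReal_re]
    field_simp
    ring

/-- The Laplacian of `-log (r^{-β} dens)`. -/
theorem hasLaplacianAt_neg_log_dens_div (β : ℝ) :
    ∀ᶠ z in 𝓝[≠] 0, HasLaplacianAt (fun w => β * Real.log ‖w‖ + (-1) * Real.log (S.dens w))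
      (16 * (‖S.cubicCoeff z‖ / ‖z‖ ^ (n : ℝ)) ^ 2 / (S.dens z / ‖z‖ ^ β) ^ 2
        * ‖z‖ ^ (2 * ((n : ℝ) - β))) z := by
  filter_upwards [eventually_mem_puncturedDisc] with z hz
  have h := ((HasLaplacianAt.log_norm (norm_pos_iff.1 hz.1)).const_mul β).add
    ((hasLaplacianAt_log_dens (S := S) hz).const_mul (-1))
  convert h using 1
  have h1 : ‖z‖ ^ (2 * ((n : ℝ) - β)) = (‖z‖ ^ (n : ℝ) / ‖z‖ ^ β) ^ 2 := by
    rw [← Real.rpow_sub hz.1, ← Real.rpow_natCast, ← Real.rpow_mul hz.1.le]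
    congr 1; push_cast; ring
  have h2 := Real.rpow_pos_of_pos hz.1 (n : ℝ)
  have h3 := Real.rpow_pos_of_pos hz.1 β
  have h4 := S.dens_pos z hz
  rw [h1]; field_simp; ring

theorem neg_log_dens_div {β : ℝ} (hz : z ∈ puncturedDisc) :
    β * Real.log ‖z‖ + (-1) * Real.log (S.dens z) = -Real.log (S.dens z / ‖z‖ ^ β) := by
  rw [Real.log_div (S.dens_pos z hz).ne' (Real.rpow_pos_of_pos hz.1 β).ne', Real.log_rpow hz.1]
  ring

theorem rpow_neg_two_le {r γ : ℝ} (hr : 0 < r) (hr1 : r < 1) (hγ : γ ≤ -2) :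
    1 / r ^ 2 ≤ r ^ γ := by
  have h := Real.rpow_le_rpow_of_exponent_ge hr hr1.le hγ
  rwa [Real.rpow_neg hr.le, Real.rpow_two, ← one_div] at h

/-- The function `-log (r^(-β) dens)` converges at the puncture, hence is bounded there. Its
Laplacian is comparable to `r^(2(n-β))`, so `n - β ≤ -1` would make it at least `c / r²`. -/
theorem order_gt_of_tendsto {β a C : ℝ}
    (hA : Tendsto (fun z => ‖S.cubicCoeff z‖ / ‖z‖ ^ (n : ℝ)) (𝓝[≠] 0) (𝓝 a)) (ha : 0 < a)
    (hC : 0 < C) (h : Tendsto (fun z => S.dens z / ‖z‖ ^ β) (𝓝[≠] 0) (𝓝 C)) :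
    -1 < (n : ℝ) - β := by
  by_contra! hle
  have hc : 0 < 16 * a ^ 2 / C ^ 2 := by positivity
  have hlim := ((hA.pow 2).const_mul 16).div (h.pow 2) (by positivity)
  have hlog : Tendsto (fun z => β * Real.log ‖z‖ + (-1) * Real.log (S.dens z)) (𝓝[≠] 0)
      (𝓝 (-Real.log C)) := by
    refine (h.log hC.ne').neg.congr' ?_
    filter_upwards [eventually_mem_puncturedDisc] with z hz using (neg_log_dens_div hz).symm
  refine HasLaplacianAt.false_of_ge_div_norm_sq (half_pos hc) (B := |Real.log C| + 1)
    (hasLaplacianAt_neg_log_dens_div (S := S) (n := n) β) ?_ ?_ ?_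
  · filter_upwards [hlim.eventually_const_lt (half_lt_self hc), eventually_mem_puncturedDisc]
      with z h1 h2
    have h3 := rpow_neg_two_le h2.1 h2.2 (by linarith : 2 * ((n : ℝ) - β) ≤ -2)
    rw [div_eq_mul_one_div]
    exact mul_le_mul h1.le h3 (by positivity) ((half_pos hc).le.trans h1.le)
  · exact hlog.eventually_le_const (by linarith [neg_le_abs (Real.log C)])
  · filter_upwards [hlog.eventually_const_le
      (show -|Real.log C| - 1 < -Real.log C by linarith [le_abs_self (Real.log C)]),
      tendsto_log_norm_nhdsNE.eventually_le_atBot 0] with z h1 h2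
    linarith

/-- Here `-log (r^(-k) dens)` is `-log (-log r)` up to a convergent term, and its Laplacian is
comparable to `r^(2(n-k)) / log² r`. Since `Δ(-log (-log r)) = 1 / (r log r)²`, the consistent
exponent is `n - k = -1`. A smaller one makes the Laplacian too large, a larger one makes it
bounded. -/
theorem order_eq_of_tendsto {k : ℤ} {a C : ℝ}
    (hA : Tendsto (fun z => ‖S.cubicCoeff z‖ / ‖z‖ ^ (n : ℝ)) (𝓝[≠] 0) (𝓝 a)) (ha : 0 < a)
    (hC : 0 < C)
    (h : Tendsto (fun z => S.dens z / (-(‖z‖ ^ k * Real.log ‖z‖))) (𝓝[≠] 0) (𝓝 C)) :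
    k = n + 1 := by
  by_contra hk
  set T : ℂ → ℝ := fun z => S.dens z / (-(‖z‖ ^ k * Real.log ‖z‖)) with hT
  have hc : 0 < 16 * a ^ 2 / C ^ 2 := by positivity
  have hlim := ((hA.pow 2).const_mul 16).div (h.pow 2) (by positivity)
  have hL : ∀ᶠ z : ℂ in 𝓝[≠] 0, Real.log ‖z‖ ≤ -1 :=
    tendsto_log_norm_nhdsNE.eventually_le_atBot (-1)
  have hD : ∀ᶠ z in 𝓝[≠] 0, S.dens z / ‖z‖ ^ (k : ℝ) = T z * -Real.log ‖z‖ := by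
    filter_upwards [eventually_mem_puncturedDisc, hL] with z hz hl
    have h1 : 0 < ‖z‖ ^ k := zpow_pos hz.1 k
    have h2 : Real.log ‖z‖ ≠ 0 := by linarith
    rw [Real.rpow_intCast, hT]; field_simp
  have hf : ∀ᶠ z in 𝓝[≠] 0, (k : ℝ) * Real.log ‖z‖ + (-1) * Real.log (S.dens z)
      = -Real.log (T z) - Real.log (-Real.log ‖z‖) := by
    filter_upwards [eventually_mem_puncturedDisc, hL, hD, h.eventually_const_lt hC]
      with z hz hl h1 h2
    rw [neg_log_dens_div hz, h1, Real.log_mul h2.ne' (by linarith)]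
    ring
  have hlogT : Tendsto (fun z => -Real.log (T z)) (𝓝[≠] 0) (𝓝 (-Real.log C)) := (h.log hC.ne').neg
  have hlapl := hasLaplacianAt_neg_log_dens_div (S := S) (n := n) (k : ℝ)
  set q : ℂ → ℝ := fun z => 16 * (‖S.cubicCoeff z‖ / ‖z‖ ^ (n : ℝ)) ^ 2 / T z ^ 2
  have hσ : ∀ᶠ z in 𝓝[≠] 0, 16 * (‖S.cubicCoeff z‖ / ‖z‖ ^ (n : ℝ)) ^ 2 /
      (S.dens z / ‖z‖ ^ (k : ℝ)) ^ 2 * ‖z‖ ^ (2 * ((n : ℝ) - k))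
      = q z * (‖z‖ ^ (2 * ((n : ℝ) - k)) / Real.log ‖z‖ ^ 2) := by
    filter_upwards [hD] with z hz
    rw [hz, mul_pow, neg_sq, ← div_div]; ring
  -- Integrality of `k` leaves a full unit of room on either side of `-1`.
  have hnk : n - k ≤ -2 ∨ 0 ≤ n - k := by omega
  rcases hnk with hnk | hnk
  · have hnk' : (n : ℝ) - k ≤ -2 := by exact_mod_cast hnk
    refine HasLaplacianAt.false_of_ge_div_norm_sq (half_pos hc) (B := |Real.log C| + 1)
      hlapl ?_ ?_ ?_
    · filter_upwards [hlim.eventually_const_lt (half_lt_self hc), eventually_mem_puncturedDisc, hσ,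
        hL] with z h1 h2 h3 h4
      rw [h3, div_eq_mul_one_div]
      refine mul_le_mul h1.le ?_ (by positivity) ((half_pos hc).le.trans h1.le)
      -- The spare factor `r²` absorbs the logarithm, through `(r log r)² ≤ 1`.
      have h5 := rpow_neg_two_le h2.1 h2.2 (by linarith : 2 * ((n : ℝ) - k) + 2 ≤ -2)
      rw [Real.rpow_add h2.1, Real.rpow_two] at h5
      have h6 : (Real.log ‖z‖ * ‖z‖) ^ 2 ≤ 1 := by
        rw [sq_le_one_iff_abs_le_one]
        exact (Real.abs_log_mul_self_lt _ h2.1 h2.2.le).le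
      have h7 : 0 < Real.log ‖z‖ ^ 2 := sq_pos_of_neg (by linarith)
      have h8 : 0 < ‖z‖ ^ 2 := by have := h2.1; positivity
      have h9 : 0 ≤ ‖z‖ ^ (2 * ((n : ℝ) - k)) := Real.rpow_nonneg (norm_nonneg _) _
      rw [le_div_iff₀ h7]
      refine le_of_mul_le_mul_right ?_ h8
      calc 1 / ‖z‖ ^ 2 * Real.log ‖z‖ ^ 2 * ‖z‖ ^ 2
          = 1 / ‖z‖ ^ 2 * (Real.log ‖z‖ * ‖z‖) ^ 2 := by ring
        _ ≤ 1 / ‖z‖ ^ 2 * 1 := by gcongr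
        _ ≤ _ := by rw [mul_one]; exact h5
    · filter_upwards [hlogT.eventually_le_const
        (show -Real.log C < |Real.log C| + 1 by linarith [neg_le_abs (Real.log C)]), hf, hL]
        with z h1 h2 h3
      rw [h2]
      linarith [Real.log_nonneg (show 1 ≤ -Real.log ‖z‖ by linarith)]
    · filter_upwards [hlogT.eventually_const_le
        (show -|Real.log C| - 1 < -Real.log C by linarith [le_abs_self (Real.log C)]), hf, hL]
        with z h1 h2 h3
      rw [h2]
      linarith [Real.log_le_sub_one_of_pos (show 0 < -Real.log ‖z‖ by linarith)]
  · have hnk' : (0 : ℝ) ≤ (n : ℝ) - k := by exact_mod_cast hnk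
    have hlogL : Tendsto (fun z : ℂ => -Real.log (-Real.log ‖z‖)) (𝓝[≠] 0) atBot :=
      tendsto_neg_atTop_atBot.comp
        (Real.tendsto_log_atTop.comp (tendsto_neg_atBot_atTop.comp tendsto_log_norm_nhdsNE))
    refine HasLaplacianAt.false_of_le (M := 16 * a ^ 2 / C ^ 2 + 1) (by positivity) hlapl ?_ ?_ ?_
    · filter_upwards [hlim.eventually_lt_const (lt_add_one _), eventually_mem_puncturedDisc, hσ,
        hL, h.eventually_const_lt hC] with z h1 h2 h3 h4 h5
      rw [h3]
      have h6 : ‖z‖ ^ (2 * ((n : ℝ) - k)) / Real.log ‖z‖ ^ 2 ≤ 1 := by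
        have h7 : 1 ≤ Real.log ‖z‖ ^ 2 := by nlinarith
        rw [div_le_one (by linarith)]
        exact (Real.rpow_le_one (norm_nonneg _) h2.2.le (by linarith)).trans h7
      have h8 : 0 ≤ q z := by positivity
      exact (mul_le_of_le_one_right h8 h6).trans h1.le
    · refine (hlogT.add_atBot hlogL).congr' ?_
      filter_upwards [hf] with z hz
      rw [hz]; ring
    · intro ε hε
      -- The growth `log (-log r) = o(-log r)` provides one half of `ε`; the convergent term uses
      -- the other half.
      have hlittle : Tendsto (fun z : ℂ => Real.log (-Real.log ‖z‖) / -Real.log ‖z‖)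
          (𝓝[≠] 0) (𝓝 0) := by
        have h1 := Real.isLittleO_log_id_atTop.tendsto_div_nhds_zero
        exact h1.comp (tendsto_neg_atBot_atTop.comp tendsto_log_norm_nhdsNE)
      filter_upwards [hf, hlittle.eventually_lt_const (half_pos hε), hL,
        hlogT.eventually_const_le (show -Real.log C - 1 < -Real.log C by linarith),
        tendsto_log_norm_nhdsNE.eventually_le_atBot ((-Real.log C - 1) / (ε / 2))]
        with z h1 h2 h3 h4 h5
      rw [div_lt_iff₀ (by linarith)] at h2
      rw [le_div_iff₀ (by positivity)] at h5
      rw [h1]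
      linarith

end SpecialKahlerStructure

/-! ### The main theorem -/

theorem mainTheorem9 (S : SpecialKahlerStructure) (n : ℤ)
    (hmero : MeromorphicAt S.cubicCoeff 0)
    (hord : meromorphicOrderAt S.cubicCoeff 0 = (n : WithTop ℤ)) :
    (∀ β : ℝ,
      (IsConicalOfOrder S.dens (β / 2) ↔ IsConicalOfOrder S.hypDens ((n : ℝ) - β)) ∧
      (IsConicalOfOrder S.dens (β / 2) → -1 < (n : ℝ) - β)) ∧
    ((∃ k : ℤ, HasLogSingularity S.dens k) ↔ HasCusp S.hypDens) ∧
    (HasLogSingularity S.dens (n + 1) ↔ HasCusp S.hypDens) := by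
  obtain ⟨a, ha, hA⟩ := SpecialKahlerStructure.tendsto_norm_cubicCoeff_div hmero hord
  have hhyp := SpecialKahlerStructure.eventually_hypDens_eq hmero hord
  have hcusp : HasLogSingularity S.dens (n + 1) ↔ HasCusp S.hypDens := by
    -- The exponent `n + 1` makes the normalizing factors match: `(r^n / (r^(n+1) log r))² = 1 / (r
    -- log r)²`.
    refine exists_tendsto_pos_iff hA ha ?_ ?_
    · filter_upwards [eventually_mem_puncturedDisc] with z hz
      have := Real.log_neg hz.1 hz.2
      exact div_pos (S.dens_pos z hz)
        (neg_pos.2 (mul_neg_of_pos_of_neg (zpow_pos hz.1 _) this))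
    · filter_upwards [eventually_mem_puncturedDisc, hhyp] with z hz h
      have h1 := (Real.log_neg hz.1 hz.2).ne
      have h2 := (S.dens_pos z hz).ne'
      have h3 := hz.1.ne'
      have h4 : ‖z‖ ^ n ≠ 0 := zpow_ne_zero _ h3
      rw [h, Real.rpow_intCast, zpow_add_one₀ h3]
      field_simp
  refine ⟨fun β => ?_, ⟨?_, fun h => ⟨n + 1, hcusp.2 h⟩⟩, hcusp⟩
  · have hβ : 2 * (β / 2) = β := by ring
    constructor
    · refine exists_tendsto_pos_iff hA ha ?_ ?_
      · filter_upwards [eventually_mem_puncturedDisc] with z hz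
        exact div_pos (S.dens_pos z hz) (Real.rpow_pos_of_pos hz.1 _)
      · filter_upwards [eventually_mem_puncturedDisc, hhyp] with z hz h
        have h1 : ‖z‖ ^ (2 * ((n : ℝ) - β)) = (‖z‖ ^ (n : ℝ) / ‖z‖ ^ β) ^ 2 := by
          rw [← Real.rpow_sub hz.1, ← Real.rpow_natCast, ← Real.rpow_mul hz.1.le]
          congr 1; push_cast; ring
        have h2 := (S.dens_pos z hz).ne'
        have h3 := (Real.rpow_pos_of_pos hz.1 (n : ℝ)).ne'
        have h4 := (Real.rpow_pos_of_pos hz.1 β).ne'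
        rw [h, h1, hβ]
        field_simp
    · rintro ⟨C, hC, h⟩
      rw [hβ] at h
      exact SpecialKahlerStructure.order_gt_of_tendsto hA ha hC h
  · rintro ⟨k, C, hC, h⟩
    have hk := SpecialKahlerStructure.order_eq_of_tendsto hA ha hC h
    exact hcusp.1 ⟨C, hC, hk ▸ h⟩
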